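/- Let $\mathbb F$ be a field of prime characteristic $p$ ($p$ arbitrary), let $a,b,c$ be positive integers, and let $Q\in\mathbb F[x,y,z]$ be a quasihomogeneous polynomial of degree $d$ with respect to the grading $\deg x=a$, $\deg y=b$, $\deg z=c$. Assume that $0$ is an isolated singular point of the surface $X=\{Q=0\}\subset\mathbb A^3$ (where the singular points are the points over $\overline{\mathbb F}$ at which $Q,Q_x,Q_y,Q_z$ all vanish). Let $A=\mathbb F[x,y,z]/(Q)$, with the Poisson bracket determined by $$\{x,y\}=Q_z,\qquad \{y,z\}=Q_x,\qquad \{z,x\}=Q_y,$$ let $HP_0(A)=A/\{A,A\}$, where $\{A,A\}$ is the linear span of all brackets, with the grading induced by that of $A$, and let $h_{HP_0(A)}(t)=\sum_{m\ge 0}\dim HP_0(A)[m]\,t^m$. Put $$g(z)=z^{a+b+c-d}\,\frac{1-z^d}{(1-z^a)(1-z^b)(1-z^c)},\qquad f(z)=g(z)-g_-(z)+g_-(z^{-1})-g_0,$$ where $g_-$ is the sum of the terms of negative degree, and $g_0$ the constant term, of the Laurent expansion of $g$ at $z=0$. Then there is a polynomial $P\in\mathbb Z[t]$ such that $$h_{HP_0(A)}(t)=\frac{(1-t^{d-a})(1-t^{d-b})(1-t^{d-c})}{(1-t^a)(1-t^b)(1-t^c)}+t^{d-a-b-c}f(t^p)+P(t),$$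 rational functions being expanded as Laurent series at $t=0$. -/

import Mathlib

noncomputable section

namespace SurfacePoisson

open MvPolynomial

/-! ### The surface `Q = 0` and its Poisson algebra

The variables `x, y, z` are `X 0, X 1, X 2`. -/

section Algebra

variable {F : Type*} [Field F]

/-- The coordinate ring `A = F[x,y,z]/(Q)` of the surface `Q = 0` in affine 3-space. -/
abbrev CoordRing (Q : MvPolynomial (Fin 3) F) : Type _ :=
  MvPolynomial (Fin 3) F ⧸ Ideal.span {Q}

/-- The Poisson bracket on `F[x,y,z]` attached to `Q`: the biderivation with
`{x,y} = Q_z`, `{y,z} = Q_x`, `{z,x} = Q_y`. -/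
def polyBracket (Q f g : MvPolynomial (Fin 3) F) : MvPolynomial (Fin 3) F :=
  pderiv 2 Q * (pderiv 0 f * pderiv 1 g - pderiv 1 f * pderiv 0 g) +
  pderiv 0 Q * (pderiv 1 f * pderiv 2 g - pderiv 2 f * pderiv 1 g) +
  pderiv 1 Q * (pderiv 2 f * pderiv 0 g - pderiv 0 f * pderiv 2 g)

theorem polyBracket_X (Q : MvPolynomial (Fin 3) F) :
    polyBracket Q (X 0) (X 1) = pderiv 2 Q ∧ polyBracket Q (X 1) (X 2) = pderiv 0 Q ∧
      polyBracket Q (X 2) (X 0) = pderiv 1 Q := by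
  simp [polyBracket, pderiv_X]

/-- The bracket descends to `F[x,y,z]/(Q)`. -/
theorem polyBracket_congr (Q : MvPolynomial (Fin 3) F) {f f' g g' : MvPolynomial (Fin 3) F}
    (hf : f - f' ∈ Ideal.span {Q}) (hg : g - g' ∈ Ideal.span {Q}) :
    polyBracket Q f g - polyBracket Q f' g' ∈ Ideal.span {Q} := by
  rw [Ideal.mem_span_singleton'] at hf hg
  obtain ⟨u, hu⟩ := hf
  obtain ⟨v, hv⟩ := hg
  obtain rfl : f = f' + u * Q := by rw [hu]; ring
  obtain rfl : g = g' + v * Q := by rw [hv]; ring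
  rw [Ideal.mem_span_singleton']
  refine ⟨polyBracket Q f' v + polyBracket Q u (g' + v * Q), ?_⟩
  simp only [polyBracket, map_add, Derivation.leibniz, smul_eq_mul]
  ring

/-- The Poisson bracket on `A = F[x,y,z]/(Q)`, induced by `polyBracket`. -/
def bracket (Q : MvPolynomial (Fin 3) F) : CoordRing Q → CoordRing Q → CoordRing Q :=
  Quotient.map₂ (polyBracket Q) (fun f f' hf g g' hg => by
    exact (Submodule.quotientRel_def _).2 (polyBracket_congr Q
      ((Submodule.quotientRel_def _).1 hf) ((Submodule.quotientRel_def _).1 hg)))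

theorem bracket_mk (Q f g : MvPolynomial (Fin 3) F) :
    bracket Q (Ideal.Quotient.mk _ f) (Ideal.Quotient.mk _ g) =
      Ideal.Quotient.mk _ (polyBracket Q f g) := rfl

/-- `{A, A}`: the linear span of all brackets. -/
def commutatorSubspace (Q : MvPolynomial (Fin 3) F) : Submodule F (CoordRing Q) :=
  Submodule.span F {u | ∃ f g : CoordRing Q, u = bracket Q f g}

/-- The zeroth Poisson homology `HP₀(A) = A/{A, A}`. -/
abbrev HP0 (Q : MvPolynomial (Fin 3) F) : Type _ :=
  CoordRing Q ⧸ commutatorSubspace Q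

/-- The component of degree `m` of `A`: the classes of the polynomials that are weighted
homogeneous of degree `m` for the weights `w`. -/
def CoordRing.component (Q : MvPolynomial (Fin 3) F) (w : Fin 3 → ℕ) (m : ℕ) :
    Submodule F (CoordRing Q) :=
  (weightedHomogeneousSubmodule F w m).map (Ideal.Quotient.mkₐ F (Ideal.span {Q})).toLinearMap

/-- The component of degree `m` of `HP₀(A)`, i.e. the image of that of `A`. -/
def HP0.component (Q : MvPolynomial (Fin 3) F) (w : Fin 3 → ℕ) (m : ℕ) :
    Submodule F (HP0 Q) :=
  (CoordRing.component Q w m).map (commutatorSubspace Q).mkQ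

/-- `v` is a geometric singular point of the surface `Q = 0` (Jacobian criterion). -/
def IsSingularPoint (Q : MvPolynomial (Fin 3) F) (v : Fin 3 → AlgebraicClosure F) : Prop :=
  aeval v Q = 0 ∧ ∀ i, aeval v (pderiv i Q) = 0

/-- The origin is an isolated singular point of the surface `Q = 0`: it is a singular point, and
some Zariski neighbourhood `h ≠ 0` of it contains no other geometric singular point. -/
def HasIsolatedSingularityAtZero (Q : MvPolynomial (Fin 3) F) : Prop :=
  IsSingularPoint Q 0 ∧
    ∃ h : MvPolynomial (Fin 3) (AlgebraicClosure F), eval 0 h ≠ 0 ∧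
      ∀ v, IsSingularPoint Q v → eval v h ≠ 0 → v = 0

/-- The Hilbert series of a vector space with a grading by components `V m`, `m ≥ 0`. -/
def hilbertSeries {Y : Type*} [AddCommGroup Y] [Module F Y] (V : ℕ → Submodule F Y) :
    PowerSeries ℚ :=
  PowerSeries.mk fun m => (Module.finrank F (V m) : ℚ)

end Algebra

/-! ### The right-hand side

Rational functions are identified with their Laurent expansions at `0`. -/

open HahnSeries

/-- The Laurent monomial `t ^ n`. -/
def mon (n : ℤ) : LaurentSeries ℚ := single n 1

/-- `φ_-`: the sum of the terms of negative degree. -/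
def negPart (φ : LaurentSeries ℚ) : LaurentSeries ℚ := truncLT 0 φ

/-- `φ_-(z⁻¹)`. -/
def negPartInv (φ : LaurentSeries ℚ) : LaurentSeries ℚ :=
  ofSuppBddBelow (fun n => (negPart φ).coeff (-n)) ⟨0, fun n hn => by
    by_contra h
    exact hn (by simp [negPart]; omega)⟩

/-- The substitution `φ(z) ↦ φ(t ^ p)`, for `p > 0`. -/
def substPow (p : ℕ) (hp : 0 < p) : LaurentSeries ℚ →+* LaurentSeries ℚ :=
  embDomainRingHom (AddMonoidHom.mulLeft (p : ℤ))
    (fun m n h => by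
      have : p ≠ 0 := hp.ne'
      simpa [this] using h)
    (fun m n => by
      have : (0 : ℤ) < p := by omega
      simp [mul_le_mul_iff_right₀ this])

/-- `(1 - t^(d-a)) (1 - t^(d-b)) (1 - t^(d-c)) / ((1 - t^a) (1 - t^b) (1 - t^c))`. -/
def jacobiSeries (a b c d : ℤ) : LaurentSeries ℚ :=
  (1 - mon (d - a)) * (1 - mon (d - b)) * (1 - mon (d - c)) /
    ((1 - mon a) * (1 - mon b) * (1 - mon c))

/-- `g(z) = z^(a+b+c-d) (1 - z^d) / ((1 - z^a) (1 - z^b) (1 - z^c))`. -/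
def gSeries (a b c d : ℤ) : LaurentSeries ℚ :=
  mon (a + b + c - d) * ((1 - mon d) / ((1 - mon a) * (1 - mon b) * (1 - mon c)))

/-- `f(z) = g(z) - g_-(z) + g_-(z⁻¹) - g_0`. -/
def fSeries (a b c d : ℤ) : LaurentSeries ℚ :=
  gSeries a b c d - negPart (gSeries a b c d) + negPartInv (gSeries a b c d) -
    HahnSeries.C ((gSeries a b c d).coeff 0)

/-- `(1 - t^(d-a)) (1 - t^(d-b)) (1 - t^(d-c)) / ((1 - t^a) (1 - t^b) (1 - t^c))
+ t^(d-a-b-c) f(t^p)`. -/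
def mainSeries (a b c d : ℤ) (p : ℕ) (hp : 0 < p) : LaurentSeries ℚ :=
  jacobiSeries a b c d + mon (d - a - b - c) * substPow p hp (fSeries a b c d)

end SurfacePoisson

end

/-! The first rational function is already a polynomial, so what has to be found is dim HP₀(A)[m]
for large m. The tool is a Cartier operator `cartier` : f ↦ Tr(Q^(p-1) f), where Tr = `frobTrace`
sends x^(pt+(p-1,…,p-1)) to x^t and kills the other monomials. Let Q' be Q with its coefficients
raised to the p-th power.

Tr kills derivatives, and Q^(p-1){f,g} is a divergence, so `cartier` kills brackets; it also maps
(Q) into (Q'). Hence it descends to HP₀(A) → F[x,y,z]/(Q'), and in large degrees this is bijective: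
surjective, because the image modulo Q' is an ideal containing every Q'_l
(`cartier_coTop_mul_pderiv`), hence the Tjurina ideal of Q', which contains everything of large
degree since the singularity is isolated; injective, because modulo {A,A} and (Q) the product Q_l^p
f depends only on `cartier` f (`pderiv_pow_mul_sub_mem_relSubmodule`). The kernel is thus carried
into the relations by the Tjurina ideal of Q' evaluated at x^p, y^p, z^p, and being finitely
generated over F[x^p,y^p,z^p] it consists of relations in large degrees
(`exists_forall_mem_relSubmodule`).

Degrees m in HP₀ and n in the target satisfy m - δ = p(n - δ) with δ = d-a-b-c. The target has
Hilbert series (1-t^d)/((1-t^a)(1-t^b)(1-t^c)), which is z^δ g(z); so t^δ g(t^p), and equally t^δ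
f(t^p), has the right coefficients in all large degrees. -/

noncomputable section

namespace SurfacePoisson

open MvPolynomial

/-! ### The Frobenius trace on polynomials -/

section FrobeniusTrace

variable {F σ : Type*} [Field F]

/-- The exponent all of whose entries are `p - 1`. -/
def topExponent (σ : Type*) [Finite σ] (p : ℕ) : σ →₀ ℕ :=
  Finsupp.equivFunOnFinite.symm fun _ => p - 1

@[simp]
theorem topExponent_apply [Finite σ] (p : ℕ) (i : σ) : topExponent σ p i = p - 1 := rfl

theorem exists_eq_smul_add_topExponent [Finite σ] {p : ℕ} (hp : 0 < p) (s : σ →₀ ℕ) :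
    (∃ t, s = p • t + topExponent σ p) ∨ ∃ i, ¬ p ∣ s i + 1 := by
  by_cases h : ∃ i, ¬ p ∣ s i + 1
  · exact Or.inr h
  · push Not at h
    choose q hq using h
    refine Or.inl ⟨Finsupp.equivFunOnFinite.symm fun i => q i - 1, ?_⟩
    ext i
    have h1 := hq i
    have h2 : 0 < q i := by
      rcases Nat.eq_zero_or_pos (q i) with h | h
      · rw [h] at h1; omega
      · exact h
    obtain ⟨r, hr⟩ : ∃ r, q i = r + 1 := ⟨q i - 1, by omega⟩
    simp only [Finsupp.coe_add, Finsupp.coe_smul, Pi.add_apply, Pi.smul_apply, smul_eq_mul,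
      Finsupp.equivFunOnFinite_symm_apply_apply, topExponent_apply]
    rw [hr] at h1 ⊢
    rw [mul_add] at h1
    simp only [Nat.add_sub_cancel]
    omega

/-- The linear map `x^(p t + (p - 1, …, p - 1)) ↦ x^t`, all other monomials being sent to `0`:
the Cartier operator on top forms, without the extraction of `p`-th roots of coefficients. -/
def frobTrace (F σ : Type*) [Field F] [Finite σ] (p : ℕ) :
    MvPolynomial σ F →ₗ[F] MvPolynomial σ F :=
  (basisMonomials σ F).constr F fun s =>
    open Classical in
    if ∀ i, p ∣ s i + 1 then monomial (s.mapRange (· / p) (Nat.zero_div p)) 1 else 0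

theorem frobTrace_monomial [Finite σ] {p : ℕ} (s : σ →₀ ℕ) (c : F) :
    frobTrace F σ p (monomial s c) =
      open Classical in
      if ∀ i, p ∣ s i + 1 then monomial (s.mapRange (· / p) (Nat.zero_div p)) c else 0 := by
  have h : monomial s c = c • basisMonomials σ F s := by
    simp [coe_basisMonomials, smul_monomial]
  rw [h, map_smul, frobTrace, Module.Basis.constr_basis]
  split_ifs <;> simp [smul_monomial]

theorem frobTrace_monomial_smul_add [Finite σ] {p : ℕ} (hp : 0 < p) (t : σ →₀ ℕ) (c : F) :
    frobTrace F σ p (monomial (p • t + topExponent σ p) c) = monomial t c := by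
  rw [frobTrace_monomial, if_pos]
  · refine congrArg (fun u => monomial u c) ?_
    ext i
    rw [Finsupp.mapRange_apply]
    simp only [Finsupp.coe_add, Finsupp.coe_smul, Pi.add_apply,
      Pi.smul_apply, smul_eq_mul, topExponent_apply]
    rw [Nat.mul_add_div hp, Nat.div_eq_of_lt (by omega), add_zero]
  · intro i
    simp only [Finsupp.coe_add, Finsupp.coe_smul, Pi.add_apply,
      Pi.smul_apply, smul_eq_mul, topExponent_apply]
    exact ⟨t i + 1, by rw [mul_add]; omega⟩

theorem frobTrace_monomial_of_not_dvd [Finite σ] {p : ℕ} {s : σ →₀ ℕ} {i : σ}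
    (hi : ¬ p ∣ s i + 1) (c : F) : frobTrace F σ p (monomial s c) = 0 := by
  rw [frobTrace_monomial, if_neg fun h => hi (h i)]

/-- An exponent of x_i congruent to -1 mod p in ∂_i f could only come from an exponent divisible by
p, and there differentiation gives the coefficient 0. -/
theorem frobTrace_pderiv [Finite σ] {p : ℕ} [CharP F p] (i : σ)
    (f : MvPolynomial σ F) : frobTrace F σ p (pderiv i f) = 0 := by
  induction f using MvPolynomial.induction_on' with
  | add f g hf hg => rw [map_add, map_add, hf, hg, add_zero]
  | monomial s c =>
    rw [pderiv_monomial]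
    by_cases h : (s i : F) = 0
    · simp [h]
    · have h1 : ¬ p ∣ s i := fun h2 => h ((CharP.cast_eq_zero_iff F p _).2 h2)
      have h2 : s i ≠ 0 := fun h3 => h1 (h3 ▸ dvd_zero p)
      apply frobTrace_monomial_of_not_dvd (i := i)
      simpa [Nat.sub_add_cancel (Nat.pos_of_ne_zero h2)] using h1

/-- Multiplication by x^(pu) does not change the residues of the exponents mod p. -/
theorem frobTrace_expand_mul [Finite σ] {p : ℕ} (hp : 0 < p) (g f : MvPolynomial σ F) :
    frobTrace F σ p (expand p g * f) = g * frobTrace F σ p f := by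
  induction g using MvPolynomial.induction_on' with
  | add g₁ g₂ h₁ h₂ => rw [map_add, add_mul, map_add, h₁, h₂, add_mul]
  | monomial u b =>
    induction f using MvPolynomial.induction_on' with
    | add f₁ f₂ h₁ h₂ => rw [mul_add, map_add, h₁, h₂, map_add, mul_add]
    | monomial s c =>
      rw [expand_monomial, monomial_mul]
      rcases exists_eq_smul_add_topExponent hp s with ⟨t, rfl⟩ | ⟨i, hi⟩
      · rw [← add_assoc, ← smul_add, frobTrace_monomial_smul_add hp,
          frobTrace_monomial_smul_add hp, monomial_mul]
      · rw [frobTrace_monomial_of_not_dvd hi, mul_zero, frobTrace_monomial_of_not_dvd (i := i)]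
        simp only [Finsupp.coe_add, Finsupp.coe_smul, Pi.add_apply, Pi.smul_apply, smul_eq_mul,
          add_assoc]
        rwa [Nat.dvd_add_right (dvd_mul_right _ _)]

/-- The Frobenius twist of a polynomial: its coefficients are raised to the `p`-th power. -/
def frobTwist (p : ℕ) [Fact p.Prime] [CharP F p] : MvPolynomial σ F →+* MvPolynomial σ F :=
  MvPolynomial.map (frobenius F p)

/-- Splitting the p-th power into a coefficient part and an F-linear exponent part keeps the
operators linear over F, which need not be perfect. -/
theorem pow_eq_expand_frobTwist (p : ℕ) [Fact p.Prime] [CharP F p] (f : MvPolynomial σ F) :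
    f ^ p = expand p (frobTwist p f) := by
  rw [frobTwist, ← map_expand, map_frobenius_expand]

theorem pderiv_frobTwist (p : ℕ) [Fact p.Prime] [CharP F p] (f : MvPolynomial σ F) (i : σ) :
    pderiv i (frobTwist p f) = frobTwist p (pderiv i f) := by
  rw [frobTwist, pderiv_map]

theorem pderiv_expand (p : ℕ) [CharP F p] (f : MvPolynomial σ F) (i : σ) :
    pderiv i (expand p f) = 0 := by
  induction f using MvPolynomial.induction_on' with
  | add f g hf hg => rw [map_add, map_add, hf, hg, add_zero]
  | monomial s c => rw [expand_monomial, pderiv_monomial]; simp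

/-- The map `f ↦ f ^ (p - 1) * D f` is additive modulo the image of the derivation `D`. -/
theorem exists_add_pow_mul_derivation {A : Type*} [CommRing A] [Algebra F A] (p : ℕ)
    [Fact p.Prime] [CharP F p] (D : Derivation F A A) (f g : A) :
    ∃ v, (f + g) ^ (p - 1) * D (f + g) = f ^ (p - 1) * D f + g ^ (p - 1) * D g + D v := by
  have hp : p.Prime := Fact.out
  obtain ⟨n, rfl⟩ : ∃ n, p = n + 1 := ⟨p - 1, by have := hp.pos; omega⟩
  have hne : ∀ k ∈ Finset.range n, ((k + 1 : ℕ) : F) ≠ 0 := fun k hk h => by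
    rw [CharP.cast_eq_zero_iff F (n + 1)] at h
    have := Nat.le_of_dvd (by omega) h
    have := Finset.mem_range.1 hk
    omega
  have hch : ∀ k ∈ Finset.range n, ((n.choose (k + 1) : ℕ) : F) = -(n.choose k : F) := by
    intro k hk
    have h1 : (((n + 1).choose (k + 1) : ℕ) : F) = 0 :=
      (CharP.cast_eq_zero_iff F (n + 1) _).2
        (hp.dvd_choose_self (by omega) (by have := Finset.mem_range.1 hk; omega))
    rw [Nat.choose_succ_succ] at h1
    push_cast at h1
    exact eq_neg_of_add_eq_zero_right h1
  -- The witness is ((f+g)^p - f^p - g^p)/p, with C(p,k+1)/p written as C(p-1,k)/(k+1), whose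
  -- denominator is invertible in F.
  refine ⟨∑ k ∈ Finset.range n, ((n.choose k : F) / ((k + 1 : ℕ) : F)) •
    (f ^ (k + 1) * g ^ (n - k)), ?_⟩
  have key : ∀ k ∈ Finset.range n,
      D (((n.choose k : F) / ((k + 1 : ℕ) : F)) • (f ^ (k + 1) * g ^ (n - k))) =
        (n.choose k : F) • (f ^ k * g ^ (n - k)) * D f +
          (n.choose (k + 1) : F) • (f ^ (k + 1) * g ^ (n - (k + 1))) * D g := by
    intro k hk
    have hk' := Finset.mem_range.1 hk
    obtain ⟨m, hm⟩ : ∃ m, n = k + 1 + m := ⟨n - (k + 1), by omega⟩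
    have h3 : n - k = m + 1 := by omega
    have h4 : n - (k + 1) = m := by omega
    have h5 : ((m + 1 : ℕ) : F) = -((k + 1 : ℕ) : F) := by
      have : ((n + 1 : ℕ) : F) = 0 := CharP.cast_eq_zero F (n + 1)
      rw [hm] at this
      push_cast at this ⊢
      linear_combination this
    have h6 : ∀ (j : ℕ) (x : A), (j : A) * x = (j : F) • x := fun j x => by
      rw [Algebra.smul_def, map_natCast]
    rw [D.map_smul, D.leibniz, D.leibniz_pow, D.leibniz_pow, h3, h4, hch k hk]
    simp only [Nat.add_sub_cancel, nsmul_eq_mul, smul_eq_mul, h6, smul_add, mul_smul_comm,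
      smul_smul, h5, smul_mul_assoc]
    rw [add_comm]
    congr 1
    · rw [div_mul_cancel₀ _ (hne k hk)]
      congr 1
      ring
    · rw [mul_neg, div_mul_cancel₀ _ (hne k hk)]
      congr 1
      ring
  rw [map_sum, Finset.sum_congr rfl key, Finset.sum_add_distrib, Nat.add_sub_cancel, map_add,
    add_pow, mul_add]
  have h7 : ∀ k, f ^ k * g ^ (n - k) * (n.choose k : A) =
      (n.choose k : F) • (f ^ k * g ^ (n - k)) := fun k => by
    rw [Algebra.smul_def, map_natCast, mul_comm]
  simp only [h7]
  nth_rw 1 [Finset.sum_range_succ]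
  rw [Finset.sum_range_succ', ← Finset.sum_mul, ← Finset.sum_mul]
  simp
  ring

/-- The monomial `∏ x_i ^ (p - 1)` over all `i ≠ l`. -/
def coTop [Finite σ] (F : Type*) [Field F] (p : ℕ) (l : σ) : MvPolynomial σ F :=
  monomial ((topExponent σ p).erase l) 1

theorem pderiv_coTop [Finite σ] (p : ℕ) (l : σ) : pderiv l (coTop F p l) = 0 := by
  simp [coTop, pderiv_monomial]

/-- The analogue of the Cartier identity C(f^(p-1) df) = df. Since ∂_l kills `coTop`, both sides are
additive in f once derivatives are discarded, so monomials suffice. -/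
theorem frobTrace_coTop_mul [Finite σ] (p : ℕ) [Fact p.Prime] [CharP F p] (l : σ)
    (f : MvPolynomial σ F) :
    frobTrace F σ p (coTop F p l * (f ^ (p - 1) * pderiv l f)) = frobTwist p (pderiv l f) := by
  have hp : p.Prime := Fact.out
  induction f using MvPolynomial.induction_on' with
  | add f g hf hg =>
    obtain ⟨v, hv⟩ := exists_add_pow_mul_derivation p (pderiv l) f g
    have h : coTop F p l * pderiv l v = pderiv l (coTop F p l * v) := by
      simp [Derivation.leibniz, pderiv_coTop]
    rw [hv, mul_add, mul_add, map_add, map_add, h, frobTrace_pderiv, add_zero, hf, hg, map_add,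
      map_add]
  | monomial s c =>
    rw [pderiv_monomial]
    by_cases h : (s l : F) = 0
    · simp [h]
    · have h2 : s l ≠ 0 := fun h3 => h (by simp [h3])
      rw [monomial_pow, coTop, monomial_mul, monomial_mul]
      have h3 : (topExponent σ p).erase l + ((p - 1) • s + (s - Finsupp.single l 1)) =
          p • (s - Finsupp.single l 1) + topExponent σ p := by
        classical
        obtain ⟨q, rfl⟩ : ∃ q, p = q + 1 := ⟨p - 1, by have := hp.pos; omega⟩
        ext i
        by_cases hi : i = l
        · subst hi
          obtain ⟨r, hr⟩ : ∃ r, s i = r + 1 := ⟨s i - 1, by omega⟩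
          simp [hr]
          ring
        · simp [Finsupp.erase_ne hi, Finsupp.single_eq_of_ne hi]
          ring
      rw [h3, frobTrace_monomial_smul_add hp.pos, frobTwist, map_monomial, RingHom.map_mul,
        _root_.map_natCast, frobenius_def, one_mul, ← mul_assoc, pow_sub_one_mul hp.ne_zero c]

theorem iterate_pderiv_monomial (l : σ) (n : ℕ) (s : σ →₀ ℕ) (c : F) :
    (pderiv l)^[n] (monomial s c) =
      monomial (s - Finsupp.single l n) (c * ((s l).descFactorial n : F)) := by
  induction n with
  | zero => simp
  | succ n ih =>
    rw [Function.iterate_succ_apply', ih, pderiv_monomial, Nat.descFactorial_succ]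
    congr 1
    · rw [tsub_tsub, ← Finsupp.single_add]
    · simp
      ring

/-- The product is (p-1)! C(k, p-1). Wilson evaluates the factorial to -1, and Lucas reduces the
binomial to C(k mod p, p-1). So ∂^(p-1) detects exponents congruent to -1, as the trace does. -/
theorem cast_descFactorial_pred (p : ℕ) [Fact p.Prime] [CharP F p] (k : ℕ) :
    ((k.descFactorial (p - 1) : ℕ) : F) = if p ∣ k + 1 then -1 else 0 := by
  have hp : p.Prime := Fact.out
  have hw : (((p - 1).factorial : ℕ) : F) = -1 := by
    have := congrArg (ZMod.castHom (dvd_refl p) F) (ZMod.wilsons_lemma p)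
    rwa [_root_.map_natCast, map_neg, map_one] at this
  have hl : (k.choose (p - 1) : ℤ) ≡ ((k % p).choose ((p - 1) % p) : ℤ) *
      ((k / p).choose ((p - 1) / p) : ℤ) [ZMOD p] := by
    exact_mod_cast Choose.choose_modEq_choose_mod_mul_choose_div
  have hlt : p - 1 < p := by have := hp.pos; omega
  rw [Nat.mod_eq_of_lt hlt, Nat.div_eq_of_lt hlt, Nat.choose_zero_right, Nat.cast_one,
    mul_one] at hl
  have hl' : ((k.choose (p - 1) : ℕ) : F) = (((k % p).choose (p - 1) : ℕ) : F) := by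
    have := (CharP.intCast_eq_intCast F p).2 hl
    simpa using this
  rw [Nat.descFactorial_eq_factorial_mul_choose, Nat.cast_mul, hw, hl']
  have h3 := Nat.mod_lt k hp.pos
  split_ifs with h
  · have : k % p = p - 1 := by
      rw [Nat.dvd_iff_mod_eq_zero, Nat.add_mod] at h
      have h1 : 1 % p = 1 := Nat.mod_eq_of_lt hp.one_lt
      rw [h1] at h
      by_contra hne
      rw [Nat.mod_eq_of_lt (by omega)] at h
      omega
    simp [this]
  · have : k % p ≠ p - 1 := by
      intro h1
      apply h
      refine ⟨k / p + 1, ?_⟩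
      have := Nat.div_add_mod k p
      rw [mul_add]
      have := hp.pos
      omega
    rw [Nat.choose_eq_zero_of_lt (by omega)]
    simp

/-- Each application of D lowers the power of q by at most one; it reaches q^m only if all k of them
hit a factor q. -/
theorem exists_iterate_derivation_pow_mul {A : Type*} [CommRing A] [Algebra F A]
    (D : Derivation F A A) (q u : A) (k m : ℕ) :
    ∃ v, D^[k] (q ^ (m + k) * u) =
      ((m + k).descFactorial k : A) * (D q) ^ k * q ^ m * u + q ^ (m + 1) * v := by
  induction k generalizing m with
  | zero => exact ⟨0, by simp⟩
  | succ k ih =>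
    obtain ⟨v, hv⟩ := ih (m + 1)
    refine ⟨((m + 1 + k).descFactorial k : A) * D ((D q) ^ k * u) + (m + 2 : ℕ) * D q * v +
      q * D v, ?_⟩
    rw [Function.iterate_succ_apply', show m + (k + 1) = m + 1 + k by ring, hv,
      Nat.descFactorial_succ, show m + 1 + k - k = m + 1 by omega]
    have h1 : ((m + 1 + k).descFactorial k : A) * (D q) ^ k * q ^ (m + 1) * u =
      ((m + 1 + k).descFactorial k : A) * ((D q ^ k * u) * q ^ (m + 1)) := by ring
    rw [h1, map_add, D.leibniz, D.leibniz (D q ^ k * u) (q ^ (m + 1)), D.leibniz _ v,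
      D.map_natCast, D.leibniz_pow, D.leibniz_pow]
    simp only [smul_eq_mul, nsmul_eq_mul, Nat.add_sub_cancel]
    push_cast
    ring

theorem exists_iterate_pderiv_pow_mul (p : ℕ) [Fact p.Prime] [CharP F p] (l : σ)
    (Q u : MvPolynomial σ F) :
    ∃ v, (pderiv l)^[p - 1] (Q ^ (p - 1) * u) = -((pderiv l Q) ^ (p - 1) * u) + Q * v := by
  have hp : p.Prime := Fact.out
  obtain ⟨v, hv⟩ := exists_iterate_derivation_pow_mul (pderiv l) Q u (p - 1) 0
  refine ⟨v, ?_⟩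
  have h : (((p - 1).descFactorial (p - 1) : ℕ) : MvPolynomial σ F) = -1 := by
    rw [← map_natCast (C : F →+* MvPolynomial σ F), cast_descFactorial_pred p,
      if_pos (by rw [Nat.sub_add_cancel hp.pos])]
    simp
  simp only [zero_add, h, pow_zero, pow_one] at hv
  rw [hv]
  ring

end FrobeniusTrace

/-! ### Relations in HP₀ and the Cartier operator of the surface -/

section Relations

variable {F : Type*} [Field F] (Q : MvPolynomial (Fin 3) F)

/-- The polynomials whose class in `A` lies in `{A, A}`. -/
def relSubmodule : Submodule F (MvPolynomial (Fin 3) F) :=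
  (commutatorSubspace Q).comap (Ideal.Quotient.mkₐ F (Ideal.span {Q})).toLinearMap

variable {Q}

theorem mem_relSubmodule {f : MvPolynomial (Fin 3) F} :
    f ∈ relSubmodule Q ↔ Ideal.Quotient.mk (Ideal.span {Q}) f ∈ commutatorSubspace Q := Iff.rfl

theorem mul_mem_relSubmodule (f : MvPolynomial (Fin 3) F) : Q * f ∈ relSubmodule Q := by
  rw [mem_relSubmodule, Ideal.Quotient.eq_zero_iff_mem.2]
  · exact zero_mem _
  · exact Ideal.mul_mem_right _ _ (Ideal.mem_span_singleton_self Q)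

theorem span_le_relSubmodule {f : MvPolynomial (Fin 3) F} (hf : f ∈ Ideal.span {Q}) :
    f ∈ relSubmodule Q := by
  obtain ⟨g, rfl⟩ := Ideal.mem_span_singleton.1 hf
  exact mul_mem_relSubmodule g

theorem polyBracket_mem_relSubmodule (f g : MvPolynomial (Fin 3) F) :
    polyBracket Q f g ∈ relSubmodule Q := by
  rw [mem_relSubmodule, ← bracket_mk]
  exact Submodule.subset_span ⟨_, _, rfl⟩

theorem relSubmodule_le {N : Submodule F (MvPolynomial (Fin 3) F)} (h₁ : ∀ f, Q * f ∈ N)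
    (h₂ : ∀ f g, polyBracket Q f g ∈ N) : relSubmodule Q ≤ N := by
  intro w hw
  have hle : commutatorSubspace Q ≤
      N.map (Ideal.Quotient.mkₐ F (Ideal.span {Q})).toLinearMap := by
    refine Submodule.span_le.2 ?_
    rintro _ ⟨f, g, rfl⟩
    obtain ⟨f, rfl⟩ := Ideal.Quotient.mk_surjective f
    obtain ⟨g, rfl⟩ := Ideal.Quotient.mk_surjective g
    exact ⟨_, h₂ f g, rfl⟩
  obtain ⟨n, hn, hnw⟩ := hle hw
  have h3 : w - n ∈ Ideal.span {Q} := Ideal.Quotient.eq.1 hnw.symm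
  obtain ⟨g, hg⟩ := Ideal.mem_span_singleton.1 h3
  rw [show w = n + Q * g by rw [← hg]; ring]
  exact N.add_mem hn (h₁ g)

/-- Polynomials in the p-th powers of the variables have zero derivatives, so the bracket is linear
over them. -/
theorem expand_mul_mem_relSubmodule (p : ℕ) [CharP F p] (g : MvPolynomial (Fin 3) F)
    {w : MvPolynomial (Fin 3) F} (hw : w ∈ relSubmodule Q) : expand p g * w ∈ relSubmodule Q := by
  suffices h : relSubmodule Q ≤
      (relSubmodule Q).comap (LinearMap.mulLeft F (expand p g)) from h hw
  refine relSubmodule_le (fun f => ?_) (fun f₁ f₂ => ?_)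
  · have : expand p g * (Q * f) = Q * (expand p g * f) := by ring
    simpa [this] using mul_mem_relSubmodule (expand p g * f)
  · have : expand p g * polyBracket Q f₁ f₂ = polyBracket Q (expand p g * f₁) f₂ := by
      simp only [polyBracket, Derivation.leibniz, pderiv_expand, smul_eq_mul]
      ring
    simpa [this] using polyBracket_mem_relSubmodule (Q := Q) (expand p g * f₁) f₂

/-- Up to sign this is the bracket of f with the third coordinate x_j. -/
theorem pderiv_mul_sub_mem_relSubmodule {i j l : Fin 3} (hij : i ≠ j) (hil : i ≠ l) (hjl : j ≠ l)
    (f : MvPolynomial (Fin 3) F) :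
    pderiv l Q * pderiv i f - pderiv i Q * pderiv l f ∈ relSubmodule Q := by
  have h := polyBracket_mem_relSubmodule (Q := Q) f (X j)
  have h' := polyBracket_mem_relSubmodule (Q := Q) (X j) f
  fin_cases i <;> fin_cases j <;> fin_cases l <;> simp at hij hil hjl <;>
    simp [polyBracket, pderiv_X] at h h' ⊢ <;>
    first
      | (convert h using 1; ring1)
      | (convert h' using 1; ring1)

/-- The monomial has a primitive in x_i because s_i + 1 is invertible; the other term of the bracket
vanishes because p divides s_l. -/
theorem monomial_mul_pderiv_mem_relSubmodule (p : ℕ) [CharP F p] {i j l : Fin 3}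
    (hij : i ≠ j) (hil : i ≠ l) (hjl : j ≠ l) {s : Fin 3 →₀ ℕ} (hi : ¬ p ∣ s i + 1)
    (hl : p ∣ s l) (c : F) : monomial s c * pderiv l Q ∈ relSubmodule Q := by
  have h := pderiv_mul_sub_mem_relSubmodule (Q := Q) hij hil hjl
    (monomial (s + Finsupp.single i 1) (c / ((s i + 1 : ℕ) : F)))
  have hne : ((s i + 1 : ℕ) : F) ≠ 0 := fun h => hi ((CharP.cast_eq_zero_iff F p _).1 h)
  have hl0 : (s l : F) = 0 := (CharP.cast_eq_zero_iff F p _).2 hl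
  have h1 : (s + Finsupp.single i 1 : Fin 3 →₀ ℕ) i = s i + 1 := by simp
  have h2 : (s + Finsupp.single i 1 : Fin 3 →₀ ℕ) l = s l := by
    simp [Finsupp.single_eq_of_ne hil.symm]
  rw [pderiv_monomial, pderiv_monomial, h1, h2, hl0, div_mul_cancel₀ _ hne, mul_zero, map_zero,
    mul_zero, sub_zero, add_tsub_cancel_right, mul_comm] at h
  exact h

/-- For a monomial x^s there are three cases. If s_l is not -1 mod p, both terms vanish. If all
exponents are -1 mod p, they cancel exactly. Otherwise the trace vanishes, and ∂_l^(p-1) x^s has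
x_l-exponent divisible by p and some other exponent not -1, so the preceding lemma applies. -/
theorem pderiv_mul_iterate_pderiv_add_mem_relSubmodule (p : ℕ) [Fact p.Prime] [CharP F p]
    (l : Fin 3) (u : MvPolynomial (Fin 3) F) :
    pderiv l Q * (pderiv l)^[p - 1] u +
      expand p (frobTrace F (Fin 3) p u) * coTop F p l * pderiv l Q ∈ relSubmodule Q := by
  have hp : p.Prime := Fact.out
  induction u using MvPolynomial.induction_on' with
  | add f g hf hg =>
    have h1 : (pderiv l)^[p - 1] (f + g) = (pderiv l)^[p - 1] f + (pderiv l)^[p - 1] g :=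
      iterate_map_add _ _ _ _
    rw [h1, map_add, map_add]
    convert! add_mem hf hg using 1
    ring
  | monomial s c =>
    rw [iterate_pderiv_monomial, cast_descFactorial_pred]
    by_cases hl : p ∣ s l + 1
    · rw [if_pos hl]
      rcases exists_eq_smul_add_topExponent hp.pos s with ⟨t, rfl⟩ | ⟨i, hi⟩
      · rw [frobTrace_monomial_smul_add hp.pos, expand_monomial, coTop, monomial_mul]
        have h1 : p • t + topExponent (Fin 3) p - Finsupp.single l (p - 1) =
            p • t + (topExponent (Fin 3) p).erase l := by
          ext k
          by_cases hk : k = l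
          · subst hk; simp
          · simp [Finsupp.erase_ne hk, Finsupp.single_eq_of_ne hk]
        rw [h1, mul_neg_one, mul_one, map_neg, mul_neg, mul_comm, neg_add_cancel]
        exact zero_mem _
      · have hil : i ≠ l := fun h => hi (h ▸ hl)
        obtain ⟨j, hij, hjl⟩ : ∃ j, i ≠ j ∧ j ≠ l :=
          (by decide : ∀ i l : Fin 3, ∃ j, i ≠ j ∧ j ≠ l) i l
        rw [frobTrace_monomial_of_not_dvd hi, map_zero, zero_mul, zero_mul, add_zero, mul_comm]
        refine monomial_mul_pderiv_mem_relSubmodule p hij hil hjl ?_ ?_ _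
        · simpa [Finsupp.single_eq_of_ne hil] using hi
        · obtain ⟨q, hq⟩ := hl
          obtain ⟨r, rfl⟩ : ∃ r, q = r + 1 := ⟨q - 1, by
            rcases q with _ | q
            · simp at hq
            · simp⟩
          refine ⟨r, ?_⟩
          have := hp.pos
          rw [mul_add] at hq
          simp
          omega
    · rw [if_neg hl, frobTrace_monomial_of_not_dvd hl]
      simp

/-- The preceding lemma for u = Q^(p-1) f, where ∂_l^(p-1) u is -Q_l^(p-1) f modulo Q. This is the
source of injectivity: up to relations, Q_l^p f is determined by `cartier` f. -/
theorem pderiv_pow_mul_sub_mem_relSubmodule (p : ℕ) [Fact p.Prime] [CharP F p] (l : Fin 3)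
    (f : MvPolynomial (Fin 3) F) :
    (pderiv l Q) ^ p * f - expand p (frobTrace F (Fin 3) p (Q ^ (p - 1) * f)) * coTop F p l *
      pderiv l Q ∈ relSubmodule Q := by
  have hp : p.Prime := Fact.out
  obtain ⟨v, hv⟩ := exists_iterate_pderiv_pow_mul p l Q f
  have h := pderiv_mul_iterate_pderiv_add_mem_relSubmodule (Q := Q) p l (Q ^ (p - 1) * f)
  rw [hv] at h
  have h2 := sub_mem (mul_mem_relSubmodule (Q := Q) (pderiv l Q * v)) h
  convert! h2 using 1
  rw [← pow_sub_one_mul hp.ne_zero (pderiv l Q)]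
  ring

/-- The Cartier operator of the surface, `f ↦ frobTrace (Q ^ (p - 1) * f)`. -/
def cartier (Q : MvPolynomial (Fin 3) F) (p : ℕ) :
    MvPolynomial (Fin 3) F →ₗ[F] MvPolynomial (Fin 3) F :=
  frobTrace F (Fin 3) p ∘ₗ LinearMap.mulLeft F (Q ^ (p - 1))

theorem cartier_apply (p : ℕ) (f : MvPolynomial (Fin 3) F) :
    cartier Q p f = frobTrace F (Fin 3) p (Q ^ (p - 1) * f) := rfl

theorem cartier_expand_mul {p : ℕ} (hp : 0 < p) (g f : MvPolynomial (Fin 3) F) :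
    cartier Q p (expand p g * f) = g * cartier Q p f := by
  rw [cartier_apply, cartier_apply, ← frobTrace_expand_mul hp]
  congr 1
  ring

theorem cartier_coTop_mul_pderiv (p : ℕ) [Fact p.Prime] [CharP F p] (l : Fin 3) :
    cartier Q p (coTop F p l * pderiv l Q) = frobTwist p (pderiv l Q) := by
  rw [cartier_apply, ← frobTrace_coTop_mul]
  congr 1
  ring

theorem pderiv_comm {R σ : Type*} [CommSemiring R] (i j : σ) (f : MvPolynomial σ R) :
    pderiv i (pderiv j f) = pderiv j (pderiv i f) := by
  classical
  ext s
  simp only [coeff_pderiv]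
  by_cases h : i = j
  · subst h; rfl
  · simp [Finsupp.single_eq_of_ne h, Finsupp.single_eq_of_ne (Ne.symm h),
      add_right_comm s (Finsupp.single i 1)]
    ring

/-- Q^(p-1){f,g} is a divergence: d(Q^(p-1)) is proportional to dQ, so the power of Q passes through
the derivatives, and the trace kills the result. -/
theorem cartier_polyBracket (p : ℕ) [Fact p.Prime] [CharP F p] (f g : MvPolynomial (Fin 3) F) :
    cartier Q p (polyBracket Q f g) = 0 := by
  set E := Q ^ (p - 1) with hE
  have hc : ∀ i j, pderiv i E * pderiv j Q = pderiv j E * pderiv i Q := by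
    intro i j
    rw [hE, Derivation.leibniz_pow, Derivation.leibniz_pow]
    simp only [smul_eq_mul, nsmul_eq_mul]
    ring
  have key : E * polyBracket Q f g =
      pderiv 0 (f * (E * (pderiv 2 Q * pderiv 1 g - pderiv 1 Q * pderiv 2 g))) +
      pderiv 1 (f * (E * (pderiv 0 Q * pderiv 2 g - pderiv 2 Q * pderiv 0 g))) +
      pderiv 2 (f * (E * (pderiv 1 Q * pderiv 0 g - pderiv 0 Q * pderiv 1 g))) := by
    simp only [polyBracket, Derivation.leibniz, map_sub, smul_eq_mul]
    rw [pderiv_comm 1 0 Q, pderiv_comm 2 0 Q, pderiv_comm 2 1 Q, pderiv_comm 1 0 g,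
      pderiv_comm 2 0 g, pderiv_comm 2 1 g]
    linear_combination f * pderiv 1 g * hc 2 0 + f * pderiv 2 g * hc 0 1 + f * pderiv 0 g * hc 1 2
  rw [cartier_apply, ← hE, key]
  simp only [map_add (frobTrace F (Fin 3) p), frobTrace_pderiv, add_zero]

theorem cartier_mul (p : ℕ) [Fact p.Prime] [CharP F p] (f : MvPolynomial (Fin 3) F) :
    cartier Q p (Q * f) = frobTwist p Q * frobTrace F (Fin 3) p f := by
  have hp : p.Prime := Fact.out
  rw [cartier_apply, ← mul_assoc, pow_sub_one_mul hp.ne_zero, pow_eq_expand_frobTwist,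
    frobTrace_expand_mul hp.pos]

theorem cartier_mem_span_of_mem_relSubmodule (p : ℕ) [Fact p.Prime] [CharP F p]
    {w : MvPolynomial (Fin 3) F} (hw : w ∈ relSubmodule Q) :
    cartier Q p w ∈ Ideal.span {frobTwist p Q} := by
  suffices h : relSubmodule Q ≤
      ((Ideal.span {frobTwist p Q}).restrictScalars F).comap (cartier Q p) from h hw
  refine relSubmodule_le (fun f => ?_) (fun f g => ?_)
  · simp only [Submodule.mem_comap, Submodule.restrictScalars_mem, cartier_mul]
    exact Ideal.mul_mem_right _ _ (Ideal.mem_span_singleton_self _)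
  · simp only [Submodule.mem_comap, Submodule.restrictScalars_mem, cartier_polyBracket]
    exact zero_mem _

/-- If `cartier` f is Q' g, the correction term contains the expansion of Q', which is Q^p, and so
lies in (Q). -/
theorem pderiv_pow_mul_mem_relSubmodule (p : ℕ) [Fact p.Prime] [CharP F p] (l : Fin 3)
    {f : MvPolynomial (Fin 3) F} (hf : cartier Q p f ∈ Ideal.span {frobTwist p Q}) :
    (pderiv l Q) ^ p * f ∈ relSubmodule Q := by
  have hp : p.Prime := Fact.out
  obtain ⟨g, hg⟩ := Ideal.mem_span_singleton.1 hf
  have h := pderiv_pow_mul_sub_mem_relSubmodule (Q := Q) p l f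
  rw [← cartier_apply, hg, map_mul, ← pow_eq_expand_frobTwist,
    ← mul_pow_sub_one hp.ne_zero Q] at h
  have h2 := add_mem h (mul_mem_relSubmodule (Q := Q)
    (Q ^ (p - 1) * expand p g * coTop F p l * pderiv l Q))
  convert! h2 using 1
  ring

end Relations

/-! ### Consequences of the isolated singularity -/

section Singular

variable {F : Type*} [Field F] {Q : MvPolynomial (Fin 3) F}

/-- The Tjurina ideal `(Q, Q_x, Q_y, Q_z)`. -/
def tjurinaIdeal (Q : MvPolynomial (Fin 3) F) : Ideal (MvPolynomial (Fin 3) F) :=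
  Ideal.span (insert Q (Set.range fun i => pderiv i Q))

/-- The shift e covers both Q (e = 0) and Q_i (e = w_i) without subtracting degrees. -/
theorem pow_mul_aeval_scale {K σ : Type*} [Field K] [Algebra F K] {w : σ → ℕ}
    {f : MvPolynomial σ F} {n e : ℕ} (hf : ∀ s ∈ f.support, Finsupp.weight w s + e = n)
    (v : σ → K) (c : K) :
    c ^ e * aeval (fun i => c ^ w i * v i) f = c ^ n * aeval v f := by
  rw [aeval_def, aeval_def, eval₂_eq, eval₂_eq, Finset.mul_sum, Finset.mul_sum]
  refine Finset.sum_congr rfl fun s hs => ?_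
  rw [← hf s hs, pow_add, Finsupp.weight_apply, Finsupp.sum]
  simp only [mul_pow, Finset.prod_mul_distrib, ← pow_mul, Finset.prod_pow_eq_pow_sum, smul_eq_mul,
    mul_comm (w _)]
  ring

theorem weight_add_of_mem_support_pderiv {σ : Type*} {w : σ → ℕ} {f : MvPolynomial σ F} {d : ℕ}
    (hf : f.IsWeightedHomogeneous w d) {i : σ} {s : σ →₀ ℕ} (hs : s ∈ (pderiv i f).support) :
    Finsupp.weight w s + w i = d := by
  rw [mem_support_iff, coeff_pderiv] at hs
  rw [← hf (left_ne_zero_of_mul hs), map_add, Finsupp.weight_single]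
  simp

/-- The scaling v ↦ (c^(w_i) v_i) preserves singular points and tends to the origin as c goes to 0.
A general nonzero c brings v into the neighbourhood h ≠ 0, where only the origin is singular. -/
theorem eq_zero_of_isSingularPoint {w : Fin 3 → ℕ} (hw : ∀ i, 0 < w i) {d : ℕ}
    (hQ : Q.IsWeightedHomogeneous w d) (hsing : HasIsolatedSingularityAtZero Q)
    {v : Fin 3 → AlgebraicClosure F} (hv : IsSingularPoint Q v) : v = 0 := by
  obtain ⟨-, h, h0, hh⟩ := hsing
  set P : Polynomial (AlgebraicClosure F) :=
    aeval (fun i => Polynomial.C (v i) * Polynomial.X ^ w i) h with hP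
  have hev : ∀ c, P.eval c = eval (fun i => c ^ w i * v i) h := by
    intro c
    have := MvPolynomial.comp_aeval_apply (B := AlgebraicClosure F)
      (fun i => Polynomial.C (v i) * Polynomial.X ^ w i) (Polynomial.aeval c) h
    rw [Polynomial.coe_aeval_eq_eval] at this
    rw [hP, this]
    simp only [Polynomial.eval_mul, Polynomial.eval_C, Polynomial.eval_pow, Polynomial.eval_X,
      mul_comm (v _), aeval_eq_eval]
  have hP0 : P.eval 0 ≠ 0 := by
    rw [hev]
    convert h0 using 3
    ext i
    simp [(hw i).ne']
  -- The extra factor X forces the chosen c to be nonzero.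
  have hPX : P * Polynomial.X ≠ 0 :=
    mul_ne_zero (fun h => hP0 (by rw [h, Polynomial.eval_zero])) Polynomial.X_ne_zero
  obtain ⟨c, hc⟩ := Polynomial.exists_eval_ne_zero_of_natDegree_lt_card (P * Polynomial.X) hPX
    (lt_of_lt_of_le (Cardinal.natCast_lt_aleph0) (Cardinal.aleph0_le_mk _))
  rw [Polynomial.eval_mul, Polynomial.eval_X] at hc
  have hc0 : c ≠ 0 := right_ne_zero_of_mul hc
  have hz := hh (fun i => c ^ w i * v i) ⟨?_, fun i => ?_⟩
    (by rw [← hev]; exact left_ne_zero_of_mul hc)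
  · ext i
    have := congrFun hz i
    simpa [hc0] using this
  · have := pow_mul_aeval_scale (K := AlgebraicClosure F) (e := 0) (n := d) (w := w) (f := Q)
      (fun s hs => hQ (mem_support_iff.1 hs)) v c
    rwa [pow_zero, one_mul, hv.1, mul_zero] at this
  · have := pow_mul_aeval_scale (K := AlgebraicClosure F)
      (fun s hs => weight_add_of_mem_support_pderiv hQ (i := i) hs) v c
    rw [hv.2 i, mul_zero] at this
    exact (mul_eq_zero.1 this).resolve_left (pow_ne_zero _ hc0)

/-- Nullstellensatz: the zero locus of the Tjurina ideal over the algebraic closure is contained in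
{0}. -/
theorem exists_X_pow_mem_tjurinaIdeal {w : Fin 3 → ℕ} (hw : ∀ i, 0 < w i) {d : ℕ}
    (hQ : Q.IsWeightedHomogeneous w d) (hsing : HasIsolatedSingularityAtZero Q) :
    ∃ N, ∀ i, X i ^ N ∈ tjurinaIdeal Q := by
  have h : ∀ i, ∃ n, X i ^ n ∈ tjurinaIdeal Q := by
    intro i
    have : X i ∈ (tjurinaIdeal Q).radical := by
      rw [← vanishingIdeal_zeroLocus_eq_radical (K := AlgebraicClosure F)]
      intro v hv
      rw [tjurinaIdeal, zeroLocus_span] at hv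
      have := eq_zero_of_isSingularPoint hw hQ hsing
        ⟨hv _ (Set.mem_insert _ _), fun j => hv _ (Set.mem_insert_of_mem _ ⟨j, rfl⟩)⟩
      simp [this]
    exact this
  choose n hn using h
  exact ⟨∑ i, n i, fun i => Ideal.pow_mem_of_pow_mem _ (hn i)
    (Finset.single_le_sum (fun _ _ => Nat.zero_le _) (Finset.mem_univ i))⟩

theorem coeff_zero_of_isSingularPoint_zero (h : IsSingularPoint Q 0) :
    coeff 0 Q = 0 ∧ ∀ i, coeff 0 (pderiv i Q) = 0 := by
  have key : ∀ f : MvPolynomial (Fin 3) F, aeval (0 : Fin 3 → AlgebraicClosure F) f = 0 →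
      coeff 0 f = 0 := by
    intro f hf
    rw [aeval_zero, map_eq_zero] at hf
    exact hf
  exact ⟨key _ h.1, fun i => key _ (h.2 i)⟩

theorem tjurinaIdeal_frobTwist (p : ℕ) [Fact p.Prime] [CharP F p] :
    (tjurinaIdeal Q).map (frobTwist p) = tjurinaIdeal (frobTwist p Q) := by
  rw [tjurinaIdeal, Ideal.map_span, Set.image_insert_eq, ← Set.range_comp, tjurinaIdeal]
  congr 3
  ext i
  rw [Function.comp_apply, pderiv_frobTwist]

/-- An ideal containing powers of all variables contains all polynomials whose monomials have
large degree. -/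
theorem exists_forall_le_weight_mem {σ : Type*} [Fintype σ] (w : σ → ℕ)
    (I : Ideal (MvPolynomial σ F)) {n : ℕ} (hn : ∀ i, X i ^ n ∈ I) :
    ∃ N, ∀ f : MvPolynomial σ F, (∀ s ∈ f.support, N ≤ Finsupp.weight w s) → f ∈ I := by
  refine ⟨∑ i, n * w i + 1, fun f hf => ?_⟩
  rw [f.as_sum]
  refine I.sum_mem fun s hs => ?_
  obtain ⟨i, hi⟩ : ∃ i, n ≤ s i := by
    by_contra! hlt
    have h1 := hf s hs
    rw [Finsupp.weight_apply, Finsupp.sum_fintype _ _ (by simp)] at h1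
    have h2 : ∑ i, s i • w i ≤ ∑ i, n * w i :=
      Finset.sum_le_sum fun i _ => Nat.mul_le_mul_right _ (hlt i).le
    omega
  have h3 : monomial s (coeff s f) = monomial (s - Finsupp.single i n) (coeff s f) * X i ^ n := by
    classical
    rw [X_pow_eq_monomial, monomial_mul, mul_one, tsub_add_cancel_of_le]
    rwa [Finsupp.single_le_iff]
  rw [h3]
  exact I.mul_mem_left _ (hn i)

end Singular

/-! ### Weighted gradings -/

section Graded

variable {F σ : Type*} [Field F]

/-- `f` is weighted homogeneous of the (possibly negative) degree `n - e`. -/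
def IsShiftHomogeneous (w : σ → ℕ) (f : MvPolynomial σ F) (n e : ℕ) : Prop :=
  ∀ s, coeff s f ≠ 0 → Finsupp.weight w s + e = n

variable {w : σ → ℕ} {f g : MvPolynomial σ F} {n n' e e' : ℕ}

theorem IsShiftHomogeneous.add (hf : IsShiftHomogeneous w f n e)
    (hg : IsShiftHomogeneous w g n e) : IsShiftHomogeneous w (f + g) n e := by
  intro s hs
  rw [coeff_add] at hs
  by_cases h : coeff s f = 0
  · rw [h, zero_add] at hs
    exact hg s hs
  · exact hf s h

theorem IsShiftHomogeneous.sub (hf : IsShiftHomogeneous w f n e)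
    (hg : IsShiftHomogeneous w g n e) : IsShiftHomogeneous w (f - g) n e := by
  intro s hs
  rw [coeff_sub] at hs
  by_cases h : coeff s f = 0
  · rw [h, zero_sub, neg_ne_zero] at hs
    exact hg s hs
  · exact hf s h

theorem IsShiftHomogeneous.mul (hf : IsShiftHomogeneous w f n e)
    (hg : IsShiftHomogeneous w g n' e') : IsShiftHomogeneous w (f * g) (n + n') (e + e') := by
  classical
  intro s hs
  obtain ⟨u, hu, v, hv, rfl⟩ := Finset.mem_add.1 (support_mul f g (mem_support_iff.2 hs))
  rw [map_add, ← hf u (mem_support_iff.1 hu), ← hg v (mem_support_iff.1 hv)]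
  ring

theorem IsShiftHomogeneous.weightedHomogeneousComponent_mem {N : Submodule F (MvPolynomial σ F)}
    (hf : IsShiftHomogeneous w f n e) (hN : f ∈ N) (m : ℕ) :
    weightedHomogeneousComponent w m f ∈ N := by
  classical
  by_cases h : m + e = n
  · have : f.IsWeightedHomogeneous w m := fun s hs => by have := hf s hs; omega
    rwa [weightedHomogeneousComponent_eq_self this]
  · rw [weightedHomogeneousComponent_eq_zero' _ _ fun s hs h' =>
      h (by rw [← h']; exact hf s (mem_support_iff.1 hs))]
    exact zero_mem _

theorem isShiftHomogeneous_iff : IsShiftHomogeneous w f n 0 ↔ f.IsWeightedHomogeneous w n :=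
  Iff.rfl

theorem isShiftHomogeneous_pderiv (hf : f.IsWeightedHomogeneous w n) (i : σ) :
    IsShiftHomogeneous w (pderiv i f) n (w i) :=
  fun _ hs => weight_add_of_mem_support_pderiv hf (mem_support_iff.2 hs)

theorem isWeightedHomogeneous_monomial_weight (s : σ →₀ ℕ) (c : F) :
    (monomial s c).IsWeightedHomogeneous w (Finsupp.weight w s) :=
  isWeightedHomogeneous_monomial _ _ _ rfl

theorem weightedHomogeneousComponent_mul_mem_span (hf : f.IsWeightedHomogeneous w n)
    (g : MvPolynomial σ F) (m : ℕ) :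
    weightedHomogeneousComponent w m (f * g) ∈ Ideal.span {f} := by
  induction g using MvPolynomial.induction_on' with
  | add g₁ g₂ h₁ h₂ => rw [mul_add, map_add]; exact add_mem h₁ h₂
  | monomial s c =>
    exact (isShiftHomogeneous_iff.2 (hf.mul
      (isWeightedHomogeneous_monomial_weight s c))).weightedHomogeneousComponent_mem
      (N := (Ideal.span {f}).restrictScalars F)
      (Ideal.mul_mem_right _ _ (Ideal.mem_span_singleton_self f)) m

theorem weightedHomogeneousComponent_mem_span (hf : f.IsWeightedHomogeneous w n)
    (hg : g ∈ Ideal.span {f}) (m : ℕ) :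
    weightedHomogeneousComponent w m g ∈ Ideal.span {f} := by
  obtain ⟨h, rfl⟩ := Ideal.mem_span_singleton.1 hg
  exact weightedHomogeneousComponent_mul_mem_span hf h m

theorem isWeightedHomogeneous_frobTwist (p : ℕ) [Fact p.Prime] [CharP F p]
    (hf : f.IsWeightedHomogeneous w n) : (frobTwist p f).IsWeightedHomogeneous w n := by
  intro s hs
  apply hf
  intro h
  apply hs
  rw [frobTwist, coeff_map, h, map_zero]

theorem coeff_frobTrace [Finite σ] {p : ℕ} (hp : 0 < p) (f : MvPolynomial σ F) (t : σ →₀ ℕ) :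
    coeff t (frobTrace F σ p f) = coeff (p • t + topExponent σ p) f := by
  classical
  induction f using MvPolynomial.induction_on' with
  | add f g hf hg => rw [map_add, coeff_add, coeff_add, hf, hg]
  | monomial s c =>
    rcases exists_eq_smul_add_topExponent hp s with ⟨u, rfl⟩ | ⟨i, hi⟩
    · rw [frobTrace_monomial_smul_add hp, coeff_monomial, coeff_monomial]
      refine if_congr ?_ rfl rfl
      rw [add_left_inj]
      refine ⟨fun h => h ▸ rfl, fun h => ?_⟩
      ext i
      have := DFunLike.congr_fun h i
      simpa [hp.ne'] using this
    · rw [frobTrace_monomial_of_not_dvd hi, coeff_zero, coeff_monomial, if_neg]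
      rintro rfl
      apply hi
      simp only [Finsupp.coe_add, Finsupp.coe_smul, Pi.add_apply,
        Pi.smul_apply, smul_eq_mul, topExponent_apply]
      exact ⟨t i + 1, by rw [mul_add]; omega⟩

theorem weight_topExponent [Fintype σ] (w : σ → ℕ) (p : ℕ) :
    Finsupp.weight w (topExponent σ p) = (p - 1) * ∑ i, w i := by
  rw [Finsupp.weight_apply, Finsupp.sum_fintype _ _ (by simp), Finset.mul_sum]
  simp

end Graded

/-! ### The Cartier operator is bijective in large degrees -/

section Large

variable {F : Type*} [Field F] {Q : MvPolynomial (Fin 3) F} {w : Fin 3 → ℕ} {d : ℕ}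

theorem isShiftHomogeneous_polyBracket_monomial (hQ : Q.IsWeightedHomogeneous w d)
    (s t : Fin 3 →₀ ℕ) (b c : F) :
    IsShiftHomogeneous w (polyBracket Q (monomial s b) (monomial t c))
      (d + Finsupp.weight w s + Finsupp.weight w t) (∑ i, w i) := by
  have h : ∀ i j k : Fin 3, w k + w i + w j = ∑ l, w l →
      IsShiftHomogeneous w (pderiv k Q * (pderiv i (monomial s b) * pderiv j (monomial t c)))
        (d + Finsupp.weight w s + Finsupp.weight w t) (∑ i, w i) := by
    intro i j k hijk
    rw [← hijk, ← mul_assoc]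
    exact ((isShiftHomogeneous_pderiv hQ k).mul (isShiftHomogeneous_pderiv
      (isWeightedHomogeneous_monomial_weight s b) i)).mul (isShiftHomogeneous_pderiv
      (isWeightedHomogeneous_monomial_weight t c) j)
  rw [Fin.sum_univ_three] at h ⊢
  simp only [polyBracket, mul_sub]
  exact (((h _ _ _ (by ring)).sub (h _ _ _ (by ring))).add
    ((h _ _ _ (by ring)).sub (h _ _ _ (by ring)))).add
    ((h _ _ _ (by ring)).sub (h _ _ _ (by ring)))

theorem polyBracket_add_left (f f' g : MvPolynomial (Fin 3) F) :
    polyBracket Q (f + f') g = polyBracket Q f g + polyBracket Q f' g := by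
  simp only [polyBracket, map_add]
  ring

theorem polyBracket_add_right (f g g' : MvPolynomial (Fin 3) F) :
    polyBracket Q f (g + g') = polyBracket Q f g + polyBracket Q f g' := by
  simp only [polyBracket, map_add]
  ring

/-- The relations form a graded subspace, since multiples of Q by monomials and brackets of
monomials are homogeneous and span it. -/
theorem weightedHomogeneousComponent_mem_relSubmodule (hQ : Q.IsWeightedHomogeneous w d)
    {f : MvPolynomial (Fin 3) F} (hf : f ∈ relSubmodule Q) (m : ℕ) :
    weightedHomogeneousComponent w m f ∈ relSubmodule Q := by
  suffices h : relSubmodule Q ≤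
      (relSubmodule Q).comap (weightedHomogeneousComponent w m) from h hf
  refine relSubmodule_le (fun f => ?_) (fun f g => ?_)
  · exact span_le_relSubmodule (weightedHomogeneousComponent_mul_mem_span hQ f m)
  · rw [Submodule.mem_comap]
    induction f using MvPolynomial.induction_on' with
    | add f₁ f₂ h₁ h₂ => rw [polyBracket_add_left, map_add]; exact add_mem h₁ h₂
    | monomial s b =>
      induction g using MvPolynomial.induction_on' with
      | add f₁ f₂ h₁ h₂ => rw [polyBracket_add_right, map_add]; exact add_mem h₁ h₂
      | monomial t c =>
        exact (isShiftHomogeneous_polyBracket_monomial hQ s t b c).weightedHomogeneousComponent_mem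
          (polyBracket_mem_relSubmodule _ _) m

/-- The coefficient of x^t in `cartier` f is that of x^(pt+(p-1,…,p-1)) in Q^(p-1) f; compare
weights. -/
theorem weight_of_coeff_cartier_ne_zero (hQ : Q.IsWeightedHomogeneous w d) {p : ℕ} (hp : 0 < p)
    {f : MvPolynomial (Fin 3) F} {m : ℕ} (hf : f.IsWeightedHomogeneous w m) {t : Fin 3 →₀ ℕ}
    (ht : coeff t (cartier Q p f) ≠ 0) :
    p * Finsupp.weight w t + (p - 1) * ∑ i, w i = m + (p - 1) * d := by
  rw [cartier_apply, coeff_frobTrace hp] at ht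
  have := ((hQ.pow (p - 1)).mul hf) ht
  rw [map_add, weight_topExponent, map_nsmul] at this
  simp only [smul_eq_mul] at this
  omega

theorem cartier_weightedHomogeneousComponent (hQ : Q.IsWeightedHomogeneous w d) {p : ℕ}
    (hp : 0 < p) {m n : ℕ} (hmn : p * n + (p - 1) * ∑ i, w i = m + (p - 1) * d)
    (f : MvPolynomial (Fin 3) F) :
    cartier Q p (weightedHomogeneousComponent w m f) =
      weightedHomogeneousComponent w n (cartier Q p f) := by
  classical
  induction f using MvPolynomial.induction_on' with
  | add f₁ f₂ h₁ h₂ => simp only [map_add, h₁, h₂]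
  | monomial s c =>
    have hs := isWeightedHomogeneous_monomial_weight (w := w) s c
    have hc := fun t => weight_of_coeff_cartier_ne_zero hQ hp hs (t := t)
    by_cases h : Finsupp.weight w s = m
    · rw [h] at hs hc
      rw [weightedHomogeneousComponent_eq_self hs, weightedHomogeneousComponent_eq_self]
      intro t ht
      have := hc t ht
      exact Nat.eq_of_mul_eq_mul_left hp (by omega)
    · rw [weightedHomogeneousComponent_eq_zero', map_zero,
        weightedHomogeneousComponent_eq_zero']
      · rintro t ht rfl
        have := hc t (mem_support_iff.1 ht)
        omega
      · intro t ht
        rw [support_monomial] at ht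
        split_ifs at ht
        · simp at ht
        · rw [Finset.mem_singleton] at ht
          rwa [ht]

/-- Polynomials are a finite module over the noetherian subring of polynomials in the x_i^p, since
each x_i is integral over it. -/
theorem exists_finset_expand {σ : Type*} [Finite σ] {p : ℕ} (hp : 0 < p)
    (N : Submodule F (MvPolynomial σ F)) (hN : ∀ g, ∀ f ∈ N, expand p g * f ∈ N) :
    ∃ G : Finset (MvPolynomial σ F), (∀ g ∈ G, g ∈ N) ∧
      ∀ f ∈ N, ∃ c : MvPolynomial σ F → MvPolynomial σ F, f = ∑ g ∈ G, expand p (c g) * g := by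
  let B : Subalgebra F (MvPolynomial σ F) := (expand p).range
  have hB : IsNoetherianRing B := AlgHom.isNoetherianRing_range _
  have hft : Algebra.FiniteType B (MvPolynomial σ F) :=
    Algebra.FiniteType.of_restrictScalars_finiteType F B _
  have hint : Algebra.IsIntegral B (MvPolynomial σ F) := by
    constructor
    intro f
    induction f using MvPolynomial.induction_on with
    | C a => exact isIntegral_algebraMap (R := B) (x := ⟨C a, C a, by simp⟩)
    | add f g hf hg => exact hf.add hg
    | mul_X f i hf =>
      refine hf.mul (IsIntegral.of_pow hp ?_)
      exact isIntegral_algebraMap (R := B) (x := ⟨X i ^ p, X i, by simp⟩)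
  have hfin : Module.Finite B (MvPolynomial σ F) := Algebra.IsIntegral.finite
  let N' : Submodule B (MvPolynomial σ F) :=
    { N.toAddSubmonoid with
      smul_mem' := by
        rintro ⟨_, g, rfl⟩ f hf
        exact hN g f hf }
  obtain ⟨G, hG⟩ : N'.FG := IsNoetherian.noetherian N'
  refine ⟨G, fun g hg => ?_, fun f hf => ?_⟩
  · have : g ∈ N' := hG ▸ Submodule.subset_span hg
    exact this
  · have hf' : f ∈ N' := hf
    rw [← hG, Submodule.mem_span_finset] at hf'
    obtain ⟨c, -, rfl⟩ := hf'
    choose c' hc' using fun g => (c g).2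
    refine ⟨c', Finset.sum_congr rfl fun g _ => ?_⟩
    have : expand p (c' g) = (c g : MvPolynomial σ F) := hc' g
    rw [this]
    rfl

theorem expand_mul_mem_relSubmodule_of_mem_tjurinaIdeal (p : ℕ) [Fact p.Prime] [CharP F p]
    {f s : MvPolynomial (Fin 3) F} (hf : cartier Q p f ∈ Ideal.span {frobTwist p Q})
    (hs : s ∈ tjurinaIdeal (frobTwist p Q)) : expand p s * f ∈ relSubmodule Q := by
  have hp : p.Prime := Fact.out
  induction hs using Submodule.span_induction with
  | mem s hs =>
    rcases hs with rfl | ⟨l, rfl⟩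
    · rw [← pow_eq_expand_frobTwist, ← mul_pow_sub_one hp.ne_zero Q, mul_assoc]
      exact mul_mem_relSubmodule _
    · dsimp only
      rw [pderiv_frobTwist, ← pow_eq_expand_frobTwist]
      exact pderiv_pow_mul_mem_relSubmodule p l hf
  | zero => simp
  | add s t _ _ hs ht => rw [map_add, add_mul]; exact add_mem hs ht
  | smul a s _ hs =>
    rw [smul_eq_mul, map_mul, mul_assoc]
    exact expand_mul_mem_relSubmodule p a hs

theorem exists_add_of_weight (w : Fin 3 → ℕ) (N : ℕ) (f : MvPolynomial (Fin 3) F) :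
    ∃ g h, f = g + h ∧ (∀ s ∈ g.support, Finsupp.weight w s < N) ∧
      ∀ s ∈ h.support, N ≤ Finsupp.weight w s := by
  induction f using MvPolynomial.induction_on' with
  | add f₁ f₂ h₁ h₂ =>
    classical
    obtain ⟨g₁, k₁, rfl, hg₁, hk₁⟩ := h₁
    obtain ⟨g₂, k₂, rfl, hg₂, hk₂⟩ := h₂
    refine ⟨g₁ + g₂, k₁ + k₂, by ring, fun s hs => ?_, fun s hs => ?_⟩
    · rcases Finset.mem_union.1 (support_add hs) with h | h
      exacts [hg₁ s h, hg₂ s h]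
    · rcases Finset.mem_union.1 (support_add hs) with h | h
      exacts [hk₁ s h, hk₂ s h]
  | monomial s c =>
    by_cases h : Finsupp.weight w s < N
    · refine ⟨monomial s c, 0, by simp, fun t ht => ?_, by simp⟩
      rwa [Finset.mem_singleton.1 (support_monomial_subset ht)]
    · refine ⟨0, monomial s c, by simp, by simp, fun t ht => ?_⟩
      rw [Finset.mem_singleton.1 (support_monomial_subset ht)]
      omega

/-- The kernel of `cartier` modulo Q' is finitely generated over polynomials in the x_i^p.
Coefficients of large weight lie in the Tjurina ideal of Q' and turn generators into relations; the
remaining ones produce only bounded degrees. -/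
theorem exists_forall_mem_relSubmodule (p : ℕ) [Fact p.Prime] [CharP F p]
    (hQ : Q.IsWeightedHomogeneous w d) {N : ℕ} (hN : ∀ i, X i ^ N ∈ tjurinaIdeal (frobTwist p Q)) :
    ∃ M, ∀ m, M ≤ m → ∀ f : MvPolynomial (Fin 3) F, f.IsWeightedHomogeneous w m →
      cartier Q p f ∈ Ideal.span {frobTwist p Q} → f ∈ relSubmodule Q := by
  classical
  have hp : p.Prime := Fact.out
  obtain ⟨n, hn⟩ := exists_forall_le_weight_mem w _ hN
  obtain ⟨G, hG, hspan⟩ := exists_finset_expand hp.pos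
    (((Ideal.span {frobTwist p Q}).restrictScalars F).comap (cartier Q p)) (by
      intro g f hf
      simp only [Submodule.mem_comap, Submodule.restrictScalars_mem] at hf ⊢
      rw [cartier_expand_mul hp.pos]
      exact Ideal.mul_mem_left _ _ hf)
  -- Coefficients of weight below n have expanded weight below p n; the supremum bounds the
  -- generators.
  refine ⟨p * n + G.sup (weightedTotalDegree w), fun m hm f hfm hf => ?_⟩
  obtain ⟨c, hc⟩ := hspan f hf
  choose lo hi hlohi hlo hhi using fun g => exists_add_of_weight w n (c g)
  have hsub : f - ∑ g ∈ G, expand p (lo g) * g ∈ relSubmodule Q := by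
    rw [hc, ← Finset.sum_sub_distrib]
    refine Submodule.sum_mem _ fun g hg => ?_
    rw [← sub_mul, ← map_sub]
    refine expand_mul_mem_relSubmodule_of_mem_tjurinaIdeal p (hG g hg) (hn _ fun s hs => ?_)
    rw [hlohi g, add_sub_cancel_left] at hs
    exact hhi g s hs
  have hz : weightedHomogeneousComponent w m (∑ g ∈ G, expand p (lo g) * g) = 0 := by
    rw [map_sum]
    refine Finset.sum_eq_zero fun g hg => ?_
    refine weightedHomogeneousComponent_eq_zero' _ _ fun s hs => ?_
    obtain ⟨u, hu, v, hv, rfl⟩ := Finset.mem_add.1 (support_mul _ _ hs)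
    rw [support_expand _ hp.ne_zero, Finset.mem_image] at hu
    obtain ⟨u, hu, rfl⟩ := hu
    have h1 := hlo g u hu
    have h2 := (le_weightedTotalDegree w hv).trans (Finset.le_sup (f := weightedTotalDegree w) hg)
    rw [map_add, map_nsmul, smul_eq_mul]
    have h3 : p * Finsupp.weight w u < p * n := Nat.mul_lt_mul_of_pos_left h1 hp.pos
    omega
  have := weightedHomogeneousComponent_mem_relSubmodule hQ hsub m
  rwa [map_sub, hz, sub_zero, weightedHomogeneousComponent_eq_self hfm] at this

/-- By linearity over expanded polynomials, the image of `cartier` is an ideal; modulo Q' it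
suffices to reach the partial derivatives of Q'. -/
theorem exists_cartier_sub_mem (p : ℕ) [Fact p.Prime] [CharP F p] {g : MvPolynomial (Fin 3) F}
    (hg : g ∈ tjurinaIdeal (frobTwist p Q)) :
    ∃ f, cartier Q p f - g ∈ Ideal.span {frobTwist p Q} := by
  have hp : p.Prime := Fact.out
  induction hg using Submodule.span_induction with
  | mem s hs =>
    rcases hs with rfl | ⟨l, rfl⟩
    · exact ⟨0, by simp⟩
    · refine ⟨coTop F p l * pderiv l Q, ?_⟩
      dsimp only
      rw [cartier_coTop_mul_pderiv, pderiv_frobTwist, sub_self]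
      exact zero_mem _
  | zero => exact ⟨0, by simp⟩
  | add s t _ _ hs ht =>
    obtain ⟨f₁, h₁⟩ := hs
    obtain ⟨f₂, h₂⟩ := ht
    exact ⟨f₁ + f₂, by rw [map_add, add_sub_add_comm]; exact add_mem h₁ h₂⟩
  | smul a s _ hs =>
    obtain ⟨f, h⟩ := hs
    refine ⟨expand p a * f, ?_⟩
    rw [cartier_expand_mul hp.pos, smul_eq_mul, ← mul_sub]
    exact Ideal.mul_mem_left _ _ h

theorem exists_isWeightedHomogeneous_cartier_sub_mem (p : ℕ) [Fact p.Prime] [CharP F p]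
    (hQ : Q.IsWeightedHomogeneous w d) {m n : ℕ}
    (hmn : p * n + (p - 1) * ∑ i, w i = m + (p - 1) * d) {g : MvPolynomial (Fin 3) F}
    (hgn : g.IsWeightedHomogeneous w n) (hg : g ∈ tjurinaIdeal (frobTwist p Q)) :
    ∃ f : MvPolynomial (Fin 3) F, f.IsWeightedHomogeneous w m ∧
      cartier Q p f - g ∈ Ideal.span {frobTwist p Q} := by
  have hp : p.Prime := Fact.out
  obtain ⟨f, hf⟩ := exists_cartier_sub_mem p hg
  refine ⟨_, weightedHomogeneousComponent_isWeightedHomogeneous m f, ?_⟩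
  have := weightedHomogeneousComponent_mem_span (isWeightedHomogeneous_frobTwist p hQ) hf n
  rwa [map_sub, weightedHomogeneousComponent_eq_self hgn,
    ← cartier_weightedHomogeneousComponent hQ hp.pos hmn] at this

theorem finrank_map_eq_of_forall {V V₁ V₂ : Type*} [AddCommGroup V] [Module F V]
    [AddCommGroup V₁] [Module F V₁] [AddCommGroup V₂] [Module F V₂] (φ : V →ₗ[F] V₁)
    (ψ : V →ₗ[F] V₂) (U : Submodule F V) (h : ∀ u ∈ U, φ u = 0 ↔ ψ u = 0) :
    Module.finrank F (U.map φ) = Module.finrank F (U.map ψ) := by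
  have hk : LinearMap.ker (φ.domRestrict U) = LinearMap.ker (ψ.domRestrict U) := by
    ext u
    simpa using h u u.2
  rw [← LinearMap.range_domRestrict, ← LinearMap.range_domRestrict]
  exact ((φ.domRestrict U).quotKerEquivRange.symm.trans
    ((Submodule.quotEquivOfEq _ _ hk).trans (ψ.domRestrict U).quotKerEquivRange)).finrank_eq

/-- In large degrees the Cartier operator identifies `HP₀(A)` with the coordinate ring of the
Frobenius twist of the surface. -/
theorem exists_finrank_component_eq (p : ℕ) [Fact p.Prime] [CharP F p]
    (hQ : Q.IsWeightedHomogeneous w d) {N : ℕ} (hN : ∀ i, X i ^ N ∈ tjurinaIdeal Q) :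
    ∃ M, ∀ m, M ≤ m →
      (∀ n, p * n + (p - 1) * ∑ i, w i = m + (p - 1) * d →
        Module.finrank F (HP0.component Q w m) =
          Module.finrank F (CoordRing.component (frobTwist p Q) w n)) ∧
      ((∀ n, p * n + (p - 1) * ∑ i, w i ≠ m + (p - 1) * d) →
        Module.finrank F (HP0.component Q w m) = 0) := by
  have hp : p.Prime := Fact.out
  have hN' : ∀ i, X i ^ N ∈ tjurinaIdeal (frobTwist p Q) := by
    intro i
    have := Ideal.mem_map_of_mem (frobTwist p) (hN i)
    rwa [tjurinaIdeal_frobTwist, map_pow, frobTwist, map_X] at this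
  obtain ⟨M, hM⟩ := exists_forall_mem_relSubmodule p hQ hN'
  obtain ⟨k, hk⟩ := exists_forall_le_weight_mem w _ hN'
  set mkA := (Ideal.Quotient.mkₐ F (Ideal.span {Q})).toLinearMap
  set mkB := (Ideal.Quotient.mkₐ F (Ideal.span {frobTwist p Q})).toLinearMap
  have hker : ∀ f, ((commutatorSubspace Q).mkQ ∘ₗ mkA) f = 0 ↔ f ∈ relSubmodule Q := by
    intro f
    rw [LinearMap.comp_apply, Submodule.mkQ_apply, Submodule.Quotient.mk_eq_zero]
    rfl
  have hkerB : ∀ f, mkB f = 0 ↔ f ∈ Ideal.span {frobTwist p Q} :=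
    fun f => Ideal.Quotient.eq_zero_iff_mem
  -- Beyond M the operator is injective; the other summands force n ≥ k, so that all of degree n
  -- lies in the Tjurina ideal of Q'.
  refine ⟨M + p * k + (p - 1) * ∑ i, w i, fun m hm => ⟨fun n hn => ?_, fun hn => ?_⟩⟩
  · have h1 : Module.finrank F (HP0.component Q w m) = Module.finrank F
        ((weightedHomogeneousSubmodule F w m).map (mkB ∘ₗ cartier Q p)) := by
      rw [HP0.component, CoordRing.component, ← Submodule.map_comp]
      refine finrank_map_eq_of_forall _ _ _ fun f hf => ?_
      rw [hker, LinearMap.comp_apply, hkerB]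
      exact ⟨cartier_mem_span_of_mem_relSubmodule p, hM m (by omega) f hf⟩
    have h2 : (weightedHomogeneousSubmodule F w m).map (mkB ∘ₗ cartier Q p) =
        CoordRing.component (frobTwist p Q) w n := by
      apply le_antisymm
      · rintro _ ⟨f, hf, rfl⟩
        refine ⟨cartier Q p f, fun t ht => ?_, rfl⟩
        have := weight_of_coeff_cartier_ne_zero hQ hp.pos hf ht
        exact Nat.eq_of_mul_eq_mul_left hp.pos (by omega)
      · rintro _ ⟨g, hg, rfl⟩
        have hkn : k ≤ n := le_of_mul_le_mul_left (by omega : p * k ≤ p * n) hp.pos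
        obtain ⟨f, hf, hfg⟩ := exists_isWeightedHomogeneous_cartier_sub_mem p hQ hn hg
          (hk g fun s hs => (hg (mem_support_iff.1 hs)).symm ▸ hkn)
        exact ⟨f, hf, sub_eq_zero.1 (by rw [LinearMap.comp_apply, ← map_sub]; exact (hkerB _).2 hfg)⟩
    rw [h1, h2]
  · have h1 : HP0.component Q w m = ⊥ := by
      rw [HP0.component, CoordRing.component, ← Submodule.map_comp, eq_bot_iff]
      rintro _ ⟨f, hf, rfl⟩
      rw [Submodule.mem_bot, hker]
      apply hM m (by omega) f hf
      have : cartier Q p f = 0 := by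
        ext t
        by_contra h
        exact hn _ (weight_of_coeff_cartier_ne_zero hQ hp.pos hf h)
      rw [this]
      exact zero_mem _
    rw [h1, finrank_bot]

end Large

/-! ### Hilbert series of the coordinate ring -/

section HilbertSeries

variable {F σ : Type*} [Field F] {w : σ → ℕ} {P : MvPolynomial σ F} {d : ℕ}

theorem weightedHomogeneousComponent_mul_of_le (hP : P.IsWeightedHomogeneous w d) {n : ℕ}
    (hn : d ≤ n) (f : MvPolynomial σ F) :
    weightedHomogeneousComponent w n (P * f) = P * weightedHomogeneousComponent w (n - d) f := by
  classical
  induction f using MvPolynomial.induction_on' with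
  | add f g hf hg => rw [mul_add, map_add, map_add, hf, hg, mul_add]
  | monomial s c =>
    have hs := isWeightedHomogeneous_monomial_weight (w := w) s c
    rw [weightedHomogeneousComponent_of_mem hs, weightedHomogeneousComponent_of_mem (hP.mul hs)]
    by_cases h : n = d + Finsupp.weight w s
    · rw [if_pos h, if_pos (by omega)]
    · rw [if_neg h, if_neg (by omega), mul_zero]

theorem weightedHomogeneousComponent_mul_of_lt (hP : P.IsWeightedHomogeneous w d) {n : ℕ}
    (hn : n < d) (f : MvPolynomial σ F) : weightedHomogeneousComponent w n (P * f) = 0 := by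
  classical
  induction f using MvPolynomial.induction_on' with
  | add f g hf hg => rw [mul_add, map_add, hf, hg, add_zero]
  | monomial s c =>
    have hs := isWeightedHomogeneous_monomial_weight (w := w) s c
    rw [weightedHomogeneousComponent_of_mem (hP.mul hs), if_neg (by omega)]

theorem finrank_weightedHomogeneousSubmodule [Finite σ] (hw : ∀ i, w i ≠ 0) (n : ℕ) :
    Module.finrank F (weightedHomogeneousSubmodule F w n) =
      (Finsupp.finite_of_nat_weight_eq w hw n).toFinset.card := by
  set S := (Finsupp.finite_of_nat_weight_eq w hw n).toFinset with hS
  have hmem : ∀ s, s ∈ S ↔ Finsupp.weight w s = n := fun s => by simp [hS]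
  have hspan : weightedHomogeneousSubmodule F w n =
      Submodule.span F (Set.range fun s : S => basisMonomials σ F (s : σ →₀ ℕ)) := by
    apply le_antisymm
    · intro f hf
      rw [f.as_sum]
      refine Submodule.sum_mem _ fun s hs => ?_
      have : monomial s (coeff s f) = coeff s f • basisMonomials σ F s := by
        simp [coe_basisMonomials, smul_monomial]
      rw [this]
      exact Submodule.smul_mem _ _ (Submodule.subset_span
        ⟨⟨s, (hmem s).2 (hf (mem_support_iff.1 hs))⟩, rfl⟩)
    · rw [Submodule.span_le]
      rintro _ ⟨s, rfl⟩
      simp only [coe_basisMonomials]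
      exact isWeightedHomogeneous_monomial _ _ _ ((hmem s).1 s.2)
  have hli : LinearIndependent F fun s : S => basisMonomials σ F (s : σ →₀ ℕ) :=
    (basisMonomials σ F).linearIndependent.comp _ Subtype.val_injective
  rw [hspan, finrank_span_eq_card hli, Fintype.card_coe]

theorem mk_ite_dvd_mul_one_sub {k : ℕ} (hk : k ≠ 0) :
    (PowerSeries.mk fun n => if k ∣ n then (1 : ℚ) else 0) * (1 - PowerSeries.X ^ k) = 1 := by
  ext n
  rw [mul_sub, mul_one, map_sub, PowerSeries.coeff_mul_X_pow', PowerSeries.coeff_mk,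
    PowerSeries.coeff_one]
  by_cases h0 : n = 0
  · subst h0; simp [hk]
  · rw [if_neg h0]
    by_cases hkn : k ≤ n
    · rw [if_pos hkn, PowerSeries.coeff_mk]
      have : k ∣ n - k ↔ k ∣ n := Nat.dvd_sub_iff_left hkn (dvd_refl k)
      simp [this]
    · rw [if_neg hkn, if_neg fun h => hkn (Nat.le_of_dvd (by omega) h), sub_zero]

theorem hilbertSeries_mul_prod [Fintype σ] (hw : ∀ i, w i ≠ 0) :
    hilbertSeries (weightedHomogeneousSubmodule F w) * ∏ i, (1 - PowerSeries.X ^ w i) = 1 := by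
  classical
  have h : hilbertSeries (weightedHomogeneousSubmodule F w) =
      ∏ i, PowerSeries.mk fun n => if w i ∣ n then (1 : ℚ) else 0 := by
    ext n
    rw [hilbertSeries, PowerSeries.coeff_mk, finrank_weightedHomogeneousSubmodule hw,
      PowerSeries.coeff_prod]
    simp only [PowerSeries.coeff_mk, Finset.prod_ite_zero, Finset.prod_const_one]
    rw [Finset.sum_boole, Nat.cast_inj]
    -- A monomial x^s of weight n corresponds to the way of writing n as the sum of the multiples
    -- w_i s_i.
    refine Finset.card_bij (fun s _ => Finsupp.equivFunOnFinite.symm fun i => w i * s i)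
      (fun s hs => ?_) (fun s _ t _ hst => ?_) (fun t ht => ?_)
    · rw [Set.Finite.mem_toFinset, Set.mem_ofPred_eq, Finsupp.weight_apply,
        Finsupp.sum_fintype _ _ (by simp)] at hs
      rw [Finset.mem_filter, Finset.mem_finsuppAntidiag]
      refine ⟨⟨?_, Finset.subset_univ _⟩, fun i _ => by simp⟩
      rw [← hs]
      simp [mul_comm]
    · ext i
      have := DFunLike.congr_fun hst i
      simpa [hw i] using this
    · rw [Finset.mem_filter, Finset.mem_finsuppAntidiag] at ht
      obtain ⟨⟨ht, -⟩, hdvd⟩ := ht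
      choose q hq using fun i => hdvd i (Finset.mem_univ i)
      refine ⟨Finsupp.equivFunOnFinite.symm q, ?_, ?_⟩
      · rw [Set.Finite.mem_toFinset, Set.mem_ofPred_eq, Finsupp.weight_apply,
          Finsupp.sum_fintype _ _ (by simp), ← ht]
        refine Finset.sum_congr rfl fun i _ => ?_
        rw [hq]
        simp [mul_comm]
      · ext i
        simp [hq]
  rw [h, ← Finset.prod_mul_distrib]
  exact Finset.prod_eq_one fun i _ => mk_ite_dvd_mul_one_sub (hw i)

/-- Rank–nullity for the quotient map in degree n, whose kernel is P times the polynomials of degree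
n - d. Below degree d this kernel is zero, where truncated subtraction would give a wrong value. -/
theorem finrank_component_add [Finite σ] (hw : ∀ i, w i ≠ 0) (hP : P.IsWeightedHomogeneous w d)
    (hP0 : P ≠ 0) (n : ℕ) :
    Module.finrank F ((weightedHomogeneousSubmodule F w n).map
        (Ideal.Quotient.mkₐ F (Ideal.span {P})).toLinearMap) +
      (if d ≤ n then Module.finrank F (weightedHomogeneousSubmodule F w (n - d)) else 0) =
      Module.finrank F (weightedHomogeneousSubmodule F w n) := by
  set φ := (Ideal.Quotient.mkₐ F (Ideal.span {P})).toLinearMap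
  set U := weightedHomogeneousSubmodule F w n
  have hfin : Module.Finite F U :=
    Module.Finite.iff_fg.2 (weightedHomogeneousSubmodule_fg _ w hw n)
  have hker : ∀ f, φ f = 0 ↔ f ∈ Ideal.span {P} := fun f => Ideal.Quotient.eq_zero_iff_mem
  have hrn := LinearMap.finrank_range_add_finrank_ker (φ.domRestrict U)
  rw [LinearMap.range_domRestrict] at hrn
  rw [← hrn]
  congr 1
  have hk : Module.finrank F (LinearMap.ker (φ.domRestrict U)) =
      Module.finrank F ((LinearMap.ker (φ.domRestrict U)).map U.subtype) :=
    (LinearEquiv.finrank_eq (Submodule.equivMapOfInjective _ U.injective_subtype _))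
  rw [hk]
  split_ifs with hdn
  · have hinj : Function.Injective (LinearMap.mulLeft F P) := mul_right_injective₀ hP0
    rw [LinearEquiv.finrank_eq (Submodule.equivMapOfInjective _ hinj
      (weightedHomogeneousSubmodule F w (n - d)))]
    refine congrArg (fun N : Submodule F (MvPolynomial σ F) => Module.finrank F N) ?_
    ext f
    constructor
    · rintro ⟨g, hg, rfl⟩
      have := hP.mul hg
      rw [Nat.add_sub_cancel' hdn] at this
      exact ⟨⟨P * g, this⟩, (hker _).2
        (Ideal.mul_mem_right _ _ (Ideal.mem_span_singleton_self P)), rfl⟩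
    · rintro ⟨⟨f, hf⟩, hf0, rfl⟩
      obtain ⟨g, rfl⟩ := Ideal.mem_span_singleton.1 ((hker f).1 hf0)
      refine ⟨_, weightedHomogeneousComponent_isWeightedHomogeneous (n - d) g, ?_⟩
      change P * _ = P * g
      rw [← weightedHomogeneousComponent_mul_of_le hP hdn]
      exact weightedHomogeneousComponent_eq_self hf
  · have : (LinearMap.ker (φ.domRestrict U)).map U.subtype = ⊥ := by
      rw [eq_bot_iff]
      rintro _ ⟨⟨f, hf⟩, hf0, rfl⟩
      obtain ⟨g, rfl⟩ := Ideal.mem_span_singleton.1 ((hker f).1 hf0)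
      have h1 := weightedHomogeneousComponent_mul_of_lt hP (not_le.1 hdn) g
      rw [weightedHomogeneousComponent_eq_self hf] at h1
      exact h1
    rw [this, finrank_bot]

theorem hilbertSeries_component_mul_prod {P : MvPolynomial (Fin 3) F} {w : Fin 3 → ℕ}
    (hw : ∀ i, w i ≠ 0) (hP : P.IsWeightedHomogeneous w d) (hP0 : P ≠ 0) :
    hilbertSeries (CoordRing.component P w) * ∏ i, (1 - PowerSeries.X ^ w i) =
      1 - PowerSeries.X ^ d := by
  have h : hilbertSeries (CoordRing.component P w) =
      hilbertSeries (weightedHomogeneousSubmodule F w) * (1 - PowerSeries.X ^ d) := by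
    ext n
    rw [mul_sub, mul_one, map_sub, PowerSeries.coeff_mul_X_pow']
    simp only [hilbertSeries, PowerSeries.coeff_mk]
    rw [← finrank_component_add hw hP hP0 n, CoordRing.component]
    split_ifs <;> simp
  rw [h, mul_right_comm, hilbertSeries_mul_prod hw, one_mul]

end HilbertSeries

/-! ### Divisibility of the weights: the first rational function is a polynomial -/

section Weights

variable {F : Type*} [Field F] {Q : MvPolynomial (Fin 3) F} {w : Fin 3 → ℕ} {d : ℕ}

/-- `Q` contains a monomial `x_i ^ e` or `x_i ^ e * x_j` with `e ≥ 1`, which fixes its degree. -/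
theorem exists_degree_eq_mul_add (hQ : Q.IsWeightedHomogeneous w d) {N : ℕ} {i : Fin 3}
    (hN : X i ^ N ∈ tjurinaIdeal Q) (h0 : coeff 0 Q = 0) (h1 : ∀ j, coeff 0 (pderiv j Q) = 0) :
    ∃ e, 0 < e ∧ (d = e * w i ∨ ∃ j, d = e * w i + w j) := by
  classical
  -- Restriction to the x_i-axis. Since X_i^N survives it, so does some generator of the Tjurina
  -- ideal, which therefore contains a pure power of x_i.
  set ψ : MvPolynomial (Fin 3) F →ₐ[F] Polynomial F := aeval (Pi.single i Polynomial.X) with hψ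
  have hpure : ∀ f : MvPolynomial (Fin 3) F, coeff 0 f = 0 → ψ f ≠ 0 →
      ∃ e, 0 < e ∧ Finsupp.single i e ∈ f.support := by
    intro f hf0 hf
    by_contra! hno
    apply hf
    rw [f.as_sum, map_sum]
    refine Finset.sum_eq_zero fun s hs => ?_
    obtain ⟨j, hji, hj⟩ : ∃ j, j ≠ i ∧ s j ≠ 0 := by
      by_contra! hall
      have hse : s = Finsupp.single i (s i) := by
        ext j
        by_cases hji : j = i
        · rw [hji]; simp
        · rw [hall j hji, Finsupp.single_eq_of_ne hji]
      rcases Nat.eq_zero_or_pos (s i) with h | h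
      · rw [h, Finsupp.single_zero] at hse
        rw [hse, mem_support_iff] at hs
        exact hs hf0
      · exact hno _ h (hse ▸ hs)
    rw [hψ, aeval_monomial, Finsupp.prod_fintype _ _ (by simp),
      Finset.prod_eq_zero (Finset.mem_univ j), mul_zero]
    rw [Pi.single_eq_of_ne hji, zero_pow hj]
  by_cases hall : ∀ f ∈ insert Q (Set.range fun j => pderiv j Q), ψ f = 0
  · have hle : tjurinaIdeal Q ≤ RingHom.ker ψ := Ideal.span_le.2 fun f hf => hall f hf
    have : ψ (X i ^ N) = 0 := hle hN
    rw [map_pow, hψ, aeval_X, Pi.single_eq_same] at this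
    exact absurd this (pow_ne_zero _ Polynomial.X_ne_zero)
  · push Not at hall
    obtain ⟨f, hf, hne⟩ := hall
    rcases hf with rfl | ⟨j, rfl⟩
    · obtain ⟨e, he, hs⟩ := hpure _ h0 hne
      refine ⟨e, he, Or.inl ?_⟩
      rw [← hQ (mem_support_iff.1 hs), Finsupp.weight_single, smul_eq_mul]
    · obtain ⟨e, he, hs⟩ := hpure _ (h1 j) hne
      refine ⟨e, he, Or.inr ⟨j, ?_⟩⟩
      rw [← weight_add_of_mem_support_pderiv hQ hs, Finsupp.weight_single, smul_eq_mul]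

/-- A quasihomogeneous polynomial with an isolated singularity is not divisible by a variable. -/
theorem exists_mem_support_eq_zero {N : ℕ} (hN : ∀ i, X i ^ N ∈ tjurinaIdeal Q)
    (h1 : ∀ j, coeff 0 (pderiv j Q) = 0) (l : Fin 3) : ∃ s ∈ Q.support, s l = 0 := by
  classical
  by_contra! hall
  -- Restriction to the plane x_l = 0. If x_l divided Q, only Q_l among the generators could
  -- survive; its restriction would divide powers of two different variables, hence be a unit,
  -- although Q_l vanishes at 0.
  set ψ : MvPolynomial (Fin 3) F →ₐ[F] MvPolynomial (Fin 3) F :=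
    aeval (fun k => if k = l then 0 else X k) with hψ
  have hz : ∀ f : MvPolynomial (Fin 3) F, (∀ s ∈ f.support, s l ≠ 0) → ψ f = 0 := by
    intro f hf
    rw [f.as_sum, map_sum]
    refine Finset.sum_eq_zero fun s hs => ?_
    rw [hψ, aeval_monomial, Finsupp.prod_fintype _ _ (by simp),
      Finset.prod_eq_zero (Finset.mem_univ l), mul_zero]
    rw [if_pos rfl, zero_pow (hf s hs)]
  have hdvd : ∀ i, i ≠ l → ψ (pderiv l Q) ∣ X i ^ N := by
    intro i hi
    have hle : tjurinaIdeal Q ≤ (Ideal.span {ψ (pderiv l Q)}).comap ψ := by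
      refine Ideal.span_le.2 fun f hf => ?_
      rw [SetLike.mem_coe, Ideal.mem_comap]
      rcases hf with rfl | ⟨j, rfl⟩
      · rw [hz _ hall]
        exact zero_mem _
      · dsimp only
        by_cases hj : j = l
        · rw [hj]
          exact Ideal.mem_span_singleton_self _
        · have hzj : ψ (pderiv j Q) = 0 := by
            refine hz _ fun s hs hsl => ?_
            rw [mem_support_iff, coeff_pderiv] at hs
            apply hall _ (mem_support_iff.2 (left_ne_zero_of_mul hs))
            simp [hsl, Finsupp.single_eq_of_ne (Ne.symm hj)]
          rw [hzj]
          exact zero_mem _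
    have := hle (hN i)
    rwa [Ideal.mem_comap, map_pow, hψ, aeval_X, if_neg hi, Ideal.mem_span_singleton] at this
  obtain ⟨i, j, hi, hj, hij⟩ : ∃ i j, i ≠ l ∧ j ≠ l ∧ i ≠ j :=
    (by decide : ∀ l : Fin 3, ∃ i j, i ≠ l ∧ j ≠ l ∧ i ≠ j) l
  have hunit : IsUnit (ψ (pderiv l Q)) := by
    obtain ⟨k, -, hk⟩ := (dvd_prime_pow (X_prime (R := F) (i := i)) N).1 (hdvd i hi)
    rcases k with _ | k
    · rw [pow_zero] at hk
      exact hk.symm.isUnit isUnit_one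
    · have h2 : X i ∣ (X j : MvPolynomial (Fin 3) F) ^ N :=
        ((dvd_pow_self _ k.succ_ne_zero).trans hk.symm.dvd).trans (hdvd j hj)
      exact absurd (X_dvd_X.1 ((X_prime (R := F) (i := i)).dvd_of_dvd_pow h2)) hij
  have hc : constantCoeff (ψ (pderiv l Q)) = constantCoeff (pderiv l Q) := by
    have : (aeval (R := F) (S₁ := F) 0).comp ψ = aeval 0 := by
      ext k
      simp only [hψ, AlgHom.comp_apply, aeval_X]
      split_ifs <;> simp
    have h3 := DFunLike.congr_fun this (pderiv l Q)
    rw [AlgHom.comp_apply, aeval_zero, aeval_zero] at h3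
    exact h3
  have h4 := hunit.map (constantCoeff (R := F) (σ := Fin 3))
  rw [hc, constantCoeff_eq, h1 l] at h4
  exact not_isUnit_zero h4

/-- The weights with a given divisor are matched by complementary degrees with this divisor. -/
theorem card_filter_dvd_le (hQ : Q.IsWeightedHomogeneous w d) {N : ℕ}
    (hN : ∀ i, X i ^ N ∈ tjurinaIdeal Q) (h0 : coeff 0 Q = 0)
    (h1 : ∀ j, coeff 0 (pderiv j Q) = 0) (k : ℕ) :
    (Finset.univ.filter fun i => k ∣ w i).card ≤
      (Finset.univ.filter fun i => k ∣ d - w i).card := by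
  by_cases hkd : k ∣ d
  · refine Finset.card_le_card fun i hi => ?_
    rw [Finset.mem_filter] at hi ⊢
    exact ⟨hi.1, Nat.dvd_sub hkd hi.2⟩
  -- If k divided two weights, a monomial of Q free of the third variable would make k divide d.
  · have hone : (Finset.univ.filter fun i => k ∣ w i).card ≤ 1 := by
      rw [Finset.card_le_one]
      intro i hi j hj
      by_contra hij
      rw [Finset.mem_filter] at hi hj
      obtain ⟨l, hl⟩ : ∃ l, ∀ m, m = i ∨ m = j ∨ m = l :=
        (by decide : ∀ i j : Fin 3, i ≠ j → ∃ l, ∀ m, m = i ∨ m = j ∨ m = l) i j hij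
      obtain ⟨s, hs, hsl⟩ := exists_mem_support_eq_zero hN h1 l
      apply hkd
      rw [← hQ (mem_support_iff.1 hs), Finsupp.weight_apply, Finsupp.sum_fintype _ _ (by simp)]
      refine Finset.dvd_sum fun m _ => ?_
      rw [smul_eq_mul]
      rcases hl m with rfl | rfl | rfl
      · exact hi.2.mul_left _
      · exact hj.2.mul_left _
      · rw [hsl, zero_mul]
        exact dvd_zero k
    rcases Finset.eq_empty_or_nonempty (Finset.univ.filter fun i => k ∣ w i) with h | ⟨i, hi⟩
    · rw [h]
      simp
    · refine hone.trans (Finset.card_pos.2 ?_)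
      rw [Finset.mem_filter] at hi
      obtain ⟨e, -, h | ⟨j, h⟩⟩ := exists_degree_eq_mul_add hQ (hN i) h0 h1
      · exact absurd (h ▸ hi.2.mul_left e) hkd
      · refine ⟨j, Finset.mem_filter.2 ⟨Finset.mem_univ j, ?_⟩⟩
        rw [h, Nat.add_sub_cancel]
        exact hi.2.mul_left e

theorem X_pow_sub_one_eq_prod_ite {n d : ℕ} (hn : 0 < n) (hnd : n ≤ d) :
    (Polynomial.X ^ n - 1 : Polynomial ℤ) =
      ∏ k ∈ Finset.Icc 1 d, if k ∣ n then Polynomial.cyclotomic k ℤ else 1 := by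
  rw [← Polynomial.prod_cyclotomic_eq_X_pow_sub_one hn, ← Finset.prod_filter]
  refine Finset.prod_congr ?_ fun _ _ => rfl
  ext k
  rw [Nat.mem_divisors, Finset.mem_filter, Finset.mem_Icc]
  refine ⟨fun h => ⟨⟨Nat.pos_of_dvd_of_pos h.1 hn, (Nat.le_of_dvd hn h.1).trans hnd⟩, h.1⟩,
    fun h => ⟨h.2, hn.ne'⟩⟩

/-- For positive exponents, the k-th cyclotomic polynomial occurs in the product as often as k
divides an exponent, so the hypothesis compares multiplicities. An exponent v_i = 0 makes the right
side zero. -/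
theorem prod_X_pow_sub_one_dvd {ι : Type*} [Fintype ι] {u v : ι → ℕ}
    (hu : ∀ i, 0 < u i)
    (h : ∀ k, (Finset.univ.filter fun i => k ∣ u i).card ≤
      (Finset.univ.filter fun i => k ∣ v i).card) :
    ∏ i, (Polynomial.X ^ u i - 1 : Polynomial ℤ) ∣ ∏ i, (Polynomial.X ^ v i - 1) := by
  by_cases hv : ∃ i, v i = 0
  · obtain ⟨i, hi⟩ := hv
    have : ∏ i, (Polynomial.X ^ v i - 1 : Polynomial ℤ) = 0 :=
      Finset.prod_eq_zero (Finset.mem_univ i) (by simp [hi])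
    rw [this]
    exact dvd_zero _
  · push Not at hv
    have key : ∀ x : ι → ℕ, (∀ i, 0 < x i) → (∀ i, x i ≤ ∑ i, (u i + v i)) →
        ∏ i, (Polynomial.X ^ x i - 1 : Polynomial ℤ) =
          ∏ k ∈ Finset.Icc 1 (∑ i, (u i + v i)),
            Polynomial.cyclotomic k ℤ ^ (Finset.univ.filter fun i => k ∣ x i).card := by
      intro x hx hxd
      rw [Finset.prod_congr rfl fun i _ => X_pow_sub_one_eq_prod_ite (hx i) (hxd i),
        Finset.prod_comm]
      refine Finset.prod_congr rfl fun k _ => ?_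
      rw [← Finset.prod_filter, Finset.prod_const]
    have hle : ∀ i, u i + v i ≤ ∑ i, (u i + v i) := fun i =>
      Finset.single_le_sum (f := fun i => u i + v i) (fun _ _ => Nat.zero_le _)
        (Finset.mem_univ i)
    rw [key u hu fun i => (Nat.le_add_right _ _).trans (hle i),
      key v (fun i => Nat.pos_of_ne_zero (hv i)) fun i => (Nat.le_add_left _ _).trans (hle i)]
    exact Finset.prod_dvd_prod_of_dvd _ _ fun k _ => pow_dvd_pow _ (h k)

theorem prod_one_sub_X_pow_dvd (hQ : Q.IsWeightedHomogeneous w d) (hw : ∀ i, 0 < w i) {N : ℕ}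
    (hN : ∀ i, X i ^ N ∈ tjurinaIdeal Q) (h0 : coeff 0 Q = 0)
    (h1 : ∀ j, coeff 0 (pderiv j Q) = 0) :
    ∏ i, (1 - Polynomial.X ^ w i : Polynomial ℤ) ∣ ∏ i, (1 - Polynomial.X ^ (d - w i)) := by
  have hneg : ∀ x : Fin 3 → ℕ, ∏ i, (1 - Polynomial.X ^ x i : Polynomial ℤ) =
      (-1) * ∏ i, (Polynomial.X ^ x i - 1) := by
    intro x
    rw [Fin.prod_univ_three, Fin.prod_univ_three]
    ring
  rw [hneg, hneg]
  exact mul_dvd_mul_left _ (prod_X_pow_sub_one_dvd hw (card_filter_dvd_le hQ hN h0 h1))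

/-- Makes the truncated d - w_i agree with the integer exponents of `jacobiSeries`. -/
theorem weight_le_degree (hQ : Q.IsWeightedHomogeneous w d) {N : ℕ}
    (hN : ∀ i, X i ^ N ∈ tjurinaIdeal Q) (h0 : coeff 0 Q = 0)
    (h1 : ∀ j, coeff 0 (pderiv j Q) = 0) (i : Fin 3) : w i ≤ d := by
  obtain ⟨e, he, h | ⟨j, h⟩⟩ := exists_degree_eq_mul_add hQ (hN i) h0 h1
  · rw [h]
    exact Nat.le_mul_of_pos_left _ he
  · rw [h]
    exact (Nat.le_mul_of_pos_left _ he).trans (Nat.le_add_right _ _)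

end Weights

end SurfacePoisson

end

noncomputable section

namespace SurfacePoisson

/-! ### Coefficients of the Laurent series -/

section Laurent

open HahnSeries

theorem mon_natCast (n : ℕ) : mon n = ofPowerSeries ℤ ℚ (PowerSeries.X ^ n) := by
  rw [ofPowerSeries_X_pow]
  rfl

theorem coeff_mon_mul (k n : ℤ) (φ : LaurentSeries ℚ) :
    (mon k * φ).coeff n = φ.coeff (n - k) := by
  rw [mon, coeff_single_mul, one_mul]

theorem coeff_ofPowerSeries_of_neg (f : PowerSeries ℚ) {n : ℤ} (hn : n < 0) :
    (ofPowerSeries ℤ ℚ f).coeff n = 0 := by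
  rw [PowerSeries.coeff_coe, if_pos hn]

theorem coeff_ofPowerSeries_natCast (f : PowerSeries ℚ) (n : ℕ) :
    (ofPowerSeries ℤ ℚ f).coeff n = PowerSeries.coeff n f :=
  ofPowerSeries_apply_coeff f n

theorem coeff_substPow_mul (p : ℕ) (hp : 0 < p) (φ : LaurentSeries ℚ) (k : ℤ) :
    (substPow p hp φ).coeff (p * k) = φ.coeff k := by
  unfold substPow
  exact embDomain_coeff

theorem coeff_substPow_of_not_dvd (p : ℕ) (hp : 0 < p) (φ : LaurentSeries ℚ) {n : ℤ}
    (hn : ¬ (p : ℤ) ∣ n) : (substPow p hp φ).coeff n = 0 := by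
  unfold substPow
  refine embDomain_of_notMem_range ?_
  rintro ⟨k, hk⟩
  exact hn ⟨k, hk.symm⟩

theorem coeff_fSeries_of_nonpos (a b c d : ℤ) {k : ℤ} (hk : k ≤ 0) :
    (fSeries a b c d).coeff k = 0 := by
  simp only [fSeries, negPartInv, negPart, coeff_sub, coeff_add, coeff_ofSuppBddBelow,
    C_apply]
  rcases hk.lt_or_eq with h | rfl
  · simp [h, hk.not_gt, coeff_single_of_ne h.ne]
  · simp

theorem coeff_fSeries_of_pos (a b c d : ℤ) {k : ℤ} (hk : 0 < k) :
    (fSeries a b c d).coeff k =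
      (gSeries a b c d).coeff k + (gSeries a b c d).coeff (-k) := by
  simp only [fSeries, negPartInv, negPart, coeff_sub, coeff_add, coeff_ofSuppBddBelow,
    C_apply]
  have h1 : ¬ (k < 0) := by omega
  simp [h1, hk, coeff_single_of_ne hk.ne']

theorem exists_eq_ofPowerSeries_polynomial {φ : LaurentSeries ℚ} (hneg : ∀ n < 0, φ.coeff n = 0)
    (hint : ∀ n, ∃ c : ℤ, φ.coeff n = c) {M : ℕ} (hM : ∀ n : ℕ, M ≤ n → φ.coeff n = 0) :
    ∃ P : Polynomial ℤ, φ = ofPowerSeries ℤ ℚ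
      ((P.map (Int.castRingHom ℚ) : Polynomial ℚ) : PowerSeries ℚ) := by
  choose c hc using hint
  refine ⟨∑ i ∈ Finset.range M, Polynomial.monomial i (c i), ?_⟩
  ext n
  rcases lt_or_ge n 0 with hn | hn
  · rw [hneg n hn, coeff_ofPowerSeries_of_neg _ hn]
  · lift n to ℕ using hn
    rw [coeff_ofPowerSeries_natCast, Polynomial.coeff_coe, Polynomial.coeff_map,
      Polynomial.finsetSum_coeff]
    simp only [Polynomial.coeff_monomial, Finset.sum_ite_eq', Finset.mem_range]
    split_ifs with h
    · rw [hc]; rfl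
    · rw [hM n (by omega), map_zero]

end Laurent

/-! ### The two rational functions and the coordinate ring -/

section Main

variable {F : Type*} [Field F] {a b c d : ℕ} {P : MvPolynomial (Fin 3) F}

theorem ofPowerSeries_hilbertSeries_eq (ha : 0 < a) (hb : 0 < b) (hc : 0 < c)
    (hP : P.IsWeightedHomogeneous ![a, b, c] d) (hP0 : P ≠ 0) :
    HahnSeries.ofPowerSeries ℤ ℚ (hilbertSeries (CoordRing.component P ![a, b, c])) =
      (1 - mon d) / ((1 - mon a) * (1 - mon b) * (1 - mon c)) := by
  have hw : ∀ i, ![a, b, c] i ≠ 0 := by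
    intro i
    fin_cases i
    exacts [ha.ne', hb.ne', hc.ne']
  have hden : (1 - mon a) * (1 - mon b) * (1 - mon c) = HahnSeries.ofPowerSeries ℤ ℚ
      (∏ i, (1 - PowerSeries.X ^ (![a, b, c] i))) := by
    rw [Fin.prod_univ_three]
    simp only [mon_natCast, map_mul, map_sub, map_one]
    rfl
  have h1 := congrArg (HahnSeries.ofPowerSeries ℤ ℚ) (hilbertSeries_mul_prod (F := F) hw)
  have h2 := congrArg (HahnSeries.ofPowerSeries ℤ ℚ) (hilbertSeries_component_mul_prod hw hP hP0)
  rw [map_mul, ← hden] at h1 h2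
  rw [map_one] at h1
  rw [map_sub, map_one, ← mon_natCast] at h2
  rw [eq_div_iff (right_ne_zero_of_mul_eq_one h1), h2]

/-- Up to a shift, g is the Hilbert series of any nonzero quasihomogeneous hypersurface with these
weights and degree; it is applied to the Frobenius twist of Q. -/
theorem coeff_gSeries (ha : 0 < a) (hb : 0 < b) (hc : 0 < c)
    (hP : P.IsWeightedHomogeneous ![a, b, c] d) (hP0 : P ≠ 0) (k : ℤ) :
    (gSeries a b c d).coeff k =
      (HahnSeries.ofPowerSeries ℤ ℚ (hilbertSeries (CoordRing.component P ![a, b, c]))).coeff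
        (k + (d - a - b - c)) := by
  rw [gSeries, coeff_mon_mul, ← ofPowerSeries_hilbertSeries_eq ha hb hc hP hP0]
  congr 1
  ring

theorem exists_coeff_gSeries_eq_intCast (ha : 0 < a) (hb : 0 < b) (hc : 0 < c)
    (hP : P.IsWeightedHomogeneous ![a, b, c] d) (hP0 : P ≠ 0) (k : ℤ) :
    ∃ z : ℤ, (gSeries a b c d).coeff k = z := by
  rw [coeff_gSeries ha hb hc hP hP0, PowerSeries.coeff_coe]
  split_ifs
  · exact ⟨0, by simp⟩
  · exact ⟨_, by rw [hilbertSeries, PowerSeries.coeff_mk]; exact (Int.cast_natCast _).symm⟩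

theorem exists_jacobiSeries_eq {Q : MvPolynomial (Fin 3) F} (ha : 0 < a) (hb : 0 < b) (hc : 0 < c)
    (hQ : Q.IsWeightedHomogeneous ![a, b, c] d) {N : ℕ}
    (hN : ∀ i, MvPolynomial.X i ^ N ∈ tjurinaIdeal Q) (h0 : MvPolynomial.coeff 0 Q = 0)
    (h1 : ∀ j, MvPolynomial.coeff 0 (MvPolynomial.pderiv j Q) = 0) :
    ∃ R : Polynomial ℤ, jacobiSeries a b c d = HahnSeries.ofPowerSeries ℤ ℚ
      ((R.map (Int.castRingHom ℚ) : Polynomial ℚ) : PowerSeries ℚ) := by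
  have hw : ∀ i, 0 < ![a, b, c] i := by
    intro i
    fin_cases i
    exacts [ha, hb, hc]
  obtain ⟨R, hR⟩ := prod_one_sub_X_pow_dvd hQ hw hN h0 h1
  have hle := weight_le_degree hQ hN h0 h1
  let θ : Polynomial ℤ →+* LaurentSeries ℚ := (HahnSeries.ofPowerSeries ℤ ℚ).comp
    (Polynomial.coeToPowerSeries.ringHom.comp (Polynomial.mapRingHom (Int.castRingHom ℚ)))
  have hθ : ∀ n : ℕ, θ (Polynomial.X ^ n) = mon n := by
    intro n
    rw [mon_natCast]
    simp [θ]
  have h2 := congrArg θ hR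
  rw [Fin.prod_univ_three, Fin.prod_univ_three] at h2
  simp only [map_mul, map_sub, map_one, hθ] at h2
  have hsub : ∀ i, ((d - ![a, b, c] i : ℕ) : ℤ) = (d : ℤ) - (![a, b, c] i : ℕ) :=
    fun i => Nat.cast_sub (hle i)
  rw [hsub, hsub, hsub] at h2
  have hne : ∀ n : ℕ, 0 < n → (1 - mon n : LaurentSeries ℚ) ≠ 0 := by
    intro n hn h
    have := congrArg (fun φ => HahnSeries.coeff φ 0) h
    have hn' : (0 : ℤ) ≠ n := by omega
    simp [mon, HahnSeries.coeff_single_of_ne hn'] at this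
  refine ⟨R, ?_⟩
  rw [jacobiSeries, div_eq_iff (mul_ne_zero (mul_ne_zero (hne a ha) (hne b hb)) (hne c hc))]
  exact h2.trans (mul_comm _ _)

end Main

end SurfacePoisson

end

/-! ### Comparison of coefficients -/

theorem proposition5p3 {F : Type*} [Field F] (p : ℕ) (hp : p.Prime) [CharP F p]
    (a b c d : ℕ) (ha : 0 < a) (hb : 0 < b) (hc : 0 < c)
    (Q : MvPolynomial (Fin 3) F)
    (hQ : MvPolynomial.IsWeightedHomogeneous ![a, b, c] Q d)
    (hsing : SurfacePoisson.HasIsolatedSingularityAtZero Q) :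
    ∃ P : Polynomial ℤ,
      HahnSeries.ofPowerSeries ℤ ℚ
          (SurfacePoisson.hilbertSeries (SurfacePoisson.HP0.component Q ![a, b, c])) =
        SurfacePoisson.mainSeries a b c d p hp.pos +
          HahnSeries.ofPowerSeries ℤ ℚ
            ((P.map (Int.castRingHom ℚ) : Polynomial ℚ) : PowerSeries ℚ) := by
  open SurfacePoisson in
  have : Fact p.Prime := ⟨hp⟩
  have hw : ∀ i, 0 < ![a, b, c] i := by
    intro i
    fin_cases i
    exacts [ha, hb, hc]
  obtain ⟨N, hN⟩ := exists_X_pow_mem_tjurinaIdeal hw hQ hsing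
  obtain ⟨h0, h1⟩ := coeff_zero_of_isSingularPoint_zero hsing.1
  obtain ⟨R, hR⟩ := exists_jacobiSeries_eq ha hb hc hQ hN h0 h1
  obtain ⟨M, hM⟩ := exists_finrank_component_eq p hQ hN
  have hQ0 : Q ≠ 0 := by
    rintro rfl
    obtain ⟨s, hs, -⟩ := exists_mem_support_eq_zero hN h1 0
    simp at hs
  have hP := isWeightedHomogeneous_frobTwist p hQ
  have hP0 : frobTwist p Q ≠ 0 := fun h =>
    hQ0 (MvPolynomial.map_injective _ (frobenius_inj F p) (by rw [map_zero]; exact h))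
  have hsum : ∑ i, ![a, b, c] i = a + b + c := by
    rw [Fin.sum_univ_three]
    rfl
  rw [hsum] at hM
  have hg := coeff_gSeries ha hb hc hP hP0
  have hgi := exists_coeff_gSeries_eq_intCast ha hb hc hP hP0
  have hpos : (1 : ℤ) ≤ p := by exact_mod_cast hp.pos
  have hpsub : ((p - 1 : ℕ) : ℤ) = p - 1 := by
    rw [Nat.cast_sub hp.one_le, Nat.cast_one]
  have hdeg : ∀ (m n : ℕ), p * n + (p - 1) * (a + b + c) = m + (p - 1) * d ↔
      (m : ℤ) - (d - a - b - c) = p * (n - (d - a - b - c)) := by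
    intro m n
    rw [← Nat.cast_inj (R := ℤ)]
    push_cast
    rw [hpsub]
    constructor <;> intro h <;> linear_combination -h
  set L := HahnSeries.ofPowerSeries ℤ ℚ (hilbertSeries (HP0.component Q ![a, b, c])) with hL
  set E := mon (d - a - b - c) * substPow p hp.pos (fSeries a b c d) with hE
  have hEc : ∀ n : ℤ, E.coeff n =
      (substPow p hp.pos (fSeries a b c d)).coeff (n - (d - a - b - c)) :=
    fun n => coeff_mon_mul _ _ _
  suffices h : ∃ P : Polynomial ℤ, L - E = HahnSeries.ofPowerSeries ℤ ℚ
      ((P.map (Int.castRingHom ℚ) : Polynomial ℚ) : PowerSeries ℚ) by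
    obtain ⟨P, hPe⟩ := h
    -- The first rational function is the polynomial R, so it is absorbed into the answer.
    refine ⟨P - R, ?_⟩
    rw [Polynomial.map_sub, Polynomial.coe_sub, map_sub, ← hPe, ← hR, mainSeries]
    ring
  -- Beyond M the dimensions are known; the remaining terms give k > d+a+b+c when m - δ = p k, which
  -- kills the coefficient of g at -k and makes k + δ nonnegative.
  refine exists_eq_ofPowerSeries_polynomial (M := M + p * (d + a + b + c) + d + 1) ?_ ?_ ?_
  · intro n hn
    rw [HahnSeries.coeff_sub, hL, coeff_ofPowerSeries_of_neg _ hn, hEc, zero_sub, neg_eq_zero]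
    by_cases hdvd : (p : ℤ) ∣ n - (d - a - b - c)
    · obtain ⟨k, hk⟩ := hdvd
      rw [hk, coeff_substPow_mul]
      rcases le_or_gt k 0 with hk0 | hk0
      · exact coeff_fSeries_of_nonpos _ _ _ _ hk0
      -- From pk + δ = n < 0 it follows that k + δ and -k + δ are negative, so both coefficients of
      -- g vanish and E has no terms of negative degree.
      · have : k ≤ p * k := le_mul_of_one_le_left hk0.le hpos
        rw [coeff_fSeries_of_pos _ _ _ _ hk0, hg, hg, coeff_ofPowerSeries_of_neg _ (by omega),
          coeff_ofPowerSeries_of_neg _ (by omega), add_zero]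
    · exact coeff_substPow_of_not_dvd _ _ _ hdvd
  · intro n
    obtain ⟨z₁, h₁⟩ : ∃ z : ℤ, L.coeff n = z := by
      rw [hL, PowerSeries.coeff_coe]
      split_ifs
      · exact ⟨0, by simp⟩
      · exact ⟨_, by rw [hilbertSeries, PowerSeries.coeff_mk]; exact (Int.cast_natCast _).symm⟩
    obtain ⟨z₂, h₂⟩ : ∃ z : ℤ, E.coeff n = z := by
      rw [hEc]
      by_cases hdvd : (p : ℤ) ∣ n - (d - a - b - c)
      · obtain ⟨k, hk⟩ := hdvd
        rw [hk, coeff_substPow_mul]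
        rcases le_or_gt k 0 with hk0 | hk0
        · exact ⟨0, by rw [coeff_fSeries_of_nonpos _ _ _ _ hk0, Int.cast_zero]⟩
        · obtain ⟨z, hz⟩ := hgi k
          obtain ⟨z', hz'⟩ := hgi (-k)
          exact ⟨z + z', by rw [coeff_fSeries_of_pos _ _ _ _ hk0, hz, hz', Int.cast_add]⟩
      · exact ⟨0, by rw [coeff_substPow_of_not_dvd _ _ _ hdvd, Int.cast_zero]⟩
    exact ⟨z₁ - z₂, by rw [HahnSeries.coeff_sub, h₁, h₂, Int.cast_sub]⟩
  · intro m hm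
    have hm' : (M : ℤ) + p * (d + a + b + c) + d + 1 ≤ m := by exact_mod_cast hm
    rw [HahnSeries.coeff_sub, hEc, hL, coeff_ofPowerSeries_natCast, hilbertSeries,
      PowerSeries.coeff_mk, sub_eq_zero]
    have hMm : M ≤ m := by omega
    obtain ⟨hM1, hM2⟩ := hM m hMm
    by_cases hdvd : (p : ℤ) ∣ m - (d - a - b - c)
    · obtain ⟨k, hk⟩ := hdvd
      have hkb : (d : ℤ) + a + b + c < k := by
        by_contra! hle
        have := mul_le_mul_of_nonneg_left hle (by omega : (0 : ℤ) ≤ p)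
        omega
      obtain ⟨n, hn⟩ : ∃ n : ℕ, (n : ℤ) = k + (d - a - b - c) :=
        ⟨(k + (d - a - b - c)).toNat, Int.toNat_of_nonneg (by omega)⟩
      rw [hk, coeff_substPow_mul, coeff_fSeries_of_pos _ _ _ _ (by omega), hg, hg,
        coeff_ofPowerSeries_of_neg _ (by omega : -k + ((d : ℤ) - a - b - c) < 0), add_zero, ← hn,
        coeff_ofPowerSeries_natCast, hilbertSeries, PowerSeries.coeff_mk, hM1 n]
      rw [hdeg, hk, hn]
      ring
    · rw [coeff_substPow_of_not_dvd _ _ _ hdvd, hM2, Nat.cast_zero]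
      intro n hn
      exact hdvd ⟨_, (hdeg m n).1 hn⟩
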